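/- **Setting.** Let $\mathsf Z\subset\mathbb R^m$ be a Borel set, and let $\{z_t\}$, $\{\zeta_t\}$, $\{\eta_t\}$ be mutually independent iid sequences with values in $\mathsf Z$ and in two measurable spaces. Let $R_t=R(z_t,\zeta_t)$ and $Y_t=Y(z_t,\eta_t)$ with $R,Y\ge 0$ measurable; write $(\hat z,\hat R,\hat Y)$ for a generic copy of $(z_t,R_t,Y_t)$. Let $\beta\in[0,1)$ and let $u:\mathbb R_+\to\{-\infty\}\cup\mathbb R$ be increasing. A feasible policy is a Borel function $c:(0,\infty)\times\mathsf Z\to\mathbb R$ with $0\le c(a,z)\le a$, extended by $c(0,z)=0$. It generates, from $(a_0,z_0)=(a,z)$, the wealth path $a_{t+1}=R_{t+1}(a_t-c(a_t,z_t))+Y_{t+1}$ and has lifetime value $V_c(a,z)=\mathbb E_{a,z}\sum_{t\ge0}\beta^t u(c(a_t,z_t))$. It is optimal if $V_d\le V_c$ on $(0,\infty)\times\mathsf Z$ for every feasible policy $d$. Let $\mathscr C$ be the set of continuous $c:(0,\infty)\times\mathsf Z\to\mathbb R$ that are increasing in the first argument, with $0<c(a,z)\le a$ and $\sup_{(a,z)}|u'(c(a,z))-u'(a)|<\infty$.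 **Assumptions.** (With the conventions $u'(0)=\infty$ and $0\cdot\infty=0$.) 1. $u$ is real-valued and twice differentiable on $(0,\infty)$ with $u'>0$, $u''<0$, $u'(c)\to\infty$ as $c\to0$ and $u'(c)\to0$ as $c\to\infty$. 2. $\beta^n\,\mathbb E R_1\cdots R_n<1$ for some $n\in\mathbb N$. 3. $\sum_{t\ge1}\beta^t\,\mathbb E Y_t<\infty$. 4. $\mathbb E\hat R<\infty$, $\mathbb E u'(\hat Y)<\infty$ and $\mathbb E\hat R\,u'(\hat Y)<\infty$. 5. $z\mapsto R(z,\zeta)$ and $z\mapsto Y(z,\eta)$ are continuous for all $\zeta$ and $\eta$. 6. There is $\alpha\in(0,1)$ with $\beta\,\mathbb E\hat R\,u'[\hat R(1-\alpha)a]\le u'(a)$ for all $a>0$ and $(1-\alpha)^n\,\mathbb E R_1\cdots R_n<1$ for some $n\in\mathbb N$. 7. $\sup_{t\ge1}\mathbb E Y_t<\infty$. 8. For each $c\in\mathscr C$ that is concave in its first argument, $s\mapsto (u')^{-1}\big[\beta\,\mathbb E\hat R\,u'(c(\hat R s+\hat Y,\hat z))\big]$ is concave on $\mathbb R_+$ (this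 holds trivially if the bracket is identically $0$). **Theorem.** Under these assumptions there is exactly one optimal policy $c^*$ in $\mathscr C$, and it depends on wealth only. The stochastic kernel $Q$ on $\mathbb R_+$ of the Markov process $a_{t+1}=R_{t+1}[a_t-c^*(a_t)]+Y_{t+1}$ has exactly one stationary distribution $\psi^*$. Let $\mathscr L$ be the linear span of the increasing $\psi^*$-integrable functions $h:\mathbb R_+\to\mathbb R$. Then, for every probability measure $\mu$ on $\mathbb R_+$, when $a_0\sim\mu$ is independent of the shocks $\{(z_t,\zeta_t,\eta_t)\}_{t\ge1}$: 1. for every $h\in\mathscr L$, $$\mathbb P_\mu\Big\{\lim_{T\to\infty}\frac1T\sum_{t=1}^T h(a_t)=\int h\,d\psi^*\Big\}=1;$$ 2. $$\mathbb P_\mu\Big\{\lim_{T\to\infty}\frac1T\sum_{t=1}^T h(a_t)=\int h\,d\psi^*\ \text{ for all bounded continuous } h:\mathbb R_+\to\mathbb R\Big\}=1.$$ -/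

import Mathlib

open MeasureTheory ProbabilityTheory Filter Topology
open scoped NNReal ENNReal BoundedContinuousFunction

noncomputable section

/-- Primitives of the income fluctuation problem with capital income risk when the exogenous
state `z_t`, with values in a subset `Z` of Euclidean space, is iid. The innovations `ζ_t` and
`η_t` take values in measurable spaces `E` and `F`. Wealth, consumption, returns and labor income
are elements of `ℝ≥0 = [0, ∞)`. Utility takes values in `{-∞} ∪ ℝ`, see `UtilityAssumption`. -/
structure IncomeFluctuation {m : ℕ} (Z : Set (EuclideanSpace ℝ (Fin m))) (E F : Type*)
    [MeasurableSpace E] [MeasurableSpace F] where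
  /-- discount factor -/
  β : ℝ≥0
  β_lt_one : β < 1
  /-- utility function -/
  u : ℝ≥0 → EReal
  /-- gross rate of return as a function of `(z, ζ)` -/
  R : Z × E → ℝ≥0
  measurable_R : Measurable R
  /-- labor income as a function of `(z, η)` -/
  Y : Z × F → ℝ≥0
  measurable_Y : Measurable Y
  /-- common law of the `z_t` -/
  zLaw : Measure Z
  isProb_z : IsProbabilityMeasure zLaw
  /-- common law of the `ζ_t` -/
  ζLaw : Measure E
  isProb_ζ : IsProbabilityMeasure ζLaw
  /-- common law of the `η_t` -/
  ηLaw : Measure F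
  isProb_η : IsProbabilityMeasure ηLaw

namespace IncomeFluctuation

variable {m : ℕ} {Z : Set (EuclideanSpace ℝ (Fin m))} {E F : Type*}
  [MeasurableSpace E] [MeasurableSpace F] (M : IncomeFluctuation Z E F)

instance : IsProbabilityMeasure M.zLaw := M.isProb_z
instance : IsProbabilityMeasure M.ζLaw := M.isProb_ζ
instance : IsProbabilityMeasure M.ηLaw := M.isProb_η

/-- Return generated by a one-period shock `(z, ζ, η)`. -/
def ret (x : Z × E × F) : ℝ≥0 := M.R (x.1, x.2.1)

/-- Labor income generated by a one-period shock `(z, ζ, η)`. -/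
def inc (x : Z × E × F) : ℝ≥0 := M.Y (x.1, x.2.2)

lemma measurable_ret : Measurable M.ret :=
  M.measurable_R.comp (measurable_fst.prodMk (measurable_fst.comp measurable_snd))

lemma measurable_inc : Measurable M.inc :=
  M.measurable_Y.comp (measurable_fst.prodMk (measurable_snd.comp measurable_snd))

/-- Law of the one-period shock `(z_t, ζ_t, η_t)`. -/
def shockLaw : Measure (Z × E × F) := M.zLaw.prod (M.ζLaw.prod M.ηLaw)

instance : IsProbabilityMeasure M.shockLaw := by unfold shockLaw; infer_instance

/-- Law of the iid sequence of shocks. Coordinate `t` is the shock of period `t + 1`. -/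
def seqLaw : Measure (ℕ → Z × E × F) := Measure.infinitePi (fun _ => M.shockLaw)

/-- The utility function as a real function of a real variable; used on `(0, ∞)` only. -/
def uReal (x : ℝ) : ℝ := (M.u x.toNNReal).toReal

/-- Marginal utility `u'`, with `u'(0) = ∞`. -/
def marg (c : ℝ≥0) : ℝ≥0∞ := if c = 0 then ⊤ else ENNReal.ofReal (deriv M.uReal c)

/-- `u : [0, ∞) → {-∞} ∪ ℝ` is increasing, real-valued and twice differentiable on `(0, ∞)` with
`u' > 0` and `u'' < 0`, and satisfies the Inada conditions. -/
structure UtilityAssumption : Prop where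
  ne_top : ∀ c, M.u c ≠ ⊤
  ne_bot : ∀ c, 0 < c → M.u c ≠ ⊥
  u_zero_le : ∀ c, M.u 0 ≤ M.u c
  differentiable : DifferentiableOn ℝ M.uReal (Set.Ioi 0)
  differentiable_deriv : DifferentiableOn ℝ (deriv M.uReal) (Set.Ioi 0)
  deriv_pos : ∀ c : ℝ, 0 < c → 0 < deriv M.uReal c
  deriv_deriv_neg : ∀ c : ℝ, 0 < c → deriv (deriv M.uReal) c < 0
  tendsto_zero : Tendsto (deriv M.uReal) (𝓝[>] 0) atTop
  tendsto_top : Tendsto (deriv M.uReal) atTop (𝓝 0)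

/-- The state path `(a_t, z_t)` generated by a policy `c` from the initial state `s`, along a
realization `w` of the shocks. -/
def statePath (c : ℝ≥0 × Z → ℝ≥0) (s : ℝ≥0 × Z) (w : ℕ → Z × E × F) : ℕ → ℝ≥0 × Z
  | 0 => s
  | t + 1 => (M.ret (w t) * ((statePath c s w t).1 - c (statePath c s w t)) + M.inc (w t), (w t).1)

/-- A feasible policy: a Borel function with `0 ≤ c(a,z) ≤ a`. A policy on `(0, ∞) × Z` is extended
to `[0, ∞) × Z` by `c(0,z) = 0`, which the second condition forces. -/
structure Feasible (c : ℝ≥0 × Z → ℝ≥0) : Prop where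
  measurable : Measurable c
  le : ∀ a z, c (a, z) ≤ a

/-- Lifetime value `E_{a,z} ∑_t β^t u(c(a_t, z_t))` in `[-∞, ∞]`: the expected discounted sum
of the positive parts minus that of the negative parts. -/
def lifetimeValue (c : ℝ≥0 × Z → ℝ≥0) (s : ℝ≥0 × Z) : EReal :=
  ((∫⁻ w, ∑' t, (M.β : ℝ≥0∞) ^ t * (M.u (c (M.statePath c s w t))).toENNReal ∂M.seqLaw : ℝ≥0∞) :
      EReal) -
    ((∫⁻ w, ∑' t, (M.β : ℝ≥0∞) ^ t * (-M.u (c (M.statePath c s w t))).toENNReal ∂M.seqLaw :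
      ℝ≥0∞) : EReal)

/-- An optimal policy: feasible, and at least as good as every feasible policy at every state
with positive wealth. -/
def IsOptimal (c : ℝ≥0 × Z → ℝ≥0) : Prop :=
  Feasible c ∧ ∀ d, Feasible d → ∀ a z, 0 < a →
    M.lifetimeValue d (a, z) ≤ M.lifetimeValue c (a, z)

/-- The class `𝒞` of candidate policies on `(0, ∞) × Z` (extended by `c(0,z) = 0`). -/
structure Candidate (c : ℝ≥0 × Z → ℝ≥0) : Prop where
  continuousOn : ContinuousOn c {s | 0 < s.1}
  mono : ∀ z, Monotone fun a => c (a, z)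
  pos : ∀ a z, 0 < a → 0 < c (a, z)
  le : ∀ a z, c (a, z) ≤ a
  bounded : ∃ K : ℝ, ∀ a z, 0 < a → |deriv M.uReal (c (a, z)) - deriv M.uReal a| ≤ K

/-- The standing assumptions. Since `z_t` is iid, expectations conditional on `z_0 = z`
do not depend on `z`. Products in `ℝ≥0∞` obey `0 * ∞ = 0`. -/
structure Assumptions : Prop where
  utility : M.UtilityAssumption
  /-- `β^n E R_1 ⋯ R_n < 1` for some `n` -/
  contraction : ∃ n : ℕ,
    (M.β : ℝ≥0∞) ^ n * ∫⁻ w, ∏ i ∈ Finset.range n, (M.ret (w i) : ℝ≥0∞) ∂M.seqLaw < 1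
  /-- `∑_{t ≥ 1} β^t E Y_t < ∞` -/
  income_sum : (∑' t : ℕ, (M.β : ℝ≥0∞) ^ (t + 1) * ∫⁻ w, (M.inc (w t) : ℝ≥0∞) ∂M.seqLaw) < ⊤
  ret_finite : ∫⁻ x, (M.ret x : ℝ≥0∞) ∂M.shockLaw < ⊤
  marg_finite : ∫⁻ x, M.marg (M.inc x) ∂M.shockLaw < ⊤
  ret_marg_finite : ∫⁻ x, (M.ret x : ℝ≥0∞) * M.marg (M.inc x) ∂M.shockLaw < ⊤
  continuous_R : ∀ ζ, Continuous fun z => M.R (z, ζ)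
  continuous_Y : ∀ η, Continuous fun z => M.Y (z, η)
  /-- some `α ∈ (0,1)` has `β E R u'(R (1-α) a) ≤ u'(a)` for all `a > 0`, and
  `(1-α)^n E R_1 ⋯ R_n < 1` for some `n` -/
  consumption_rate : ∃ α : ℝ≥0, 0 < α ∧ α < 1 ∧
    (∀ a : ℝ≥0, 0 < a →
      (M.β : ℝ≥0∞) * ∫⁻ x, (M.ret x : ℝ≥0∞) * M.marg (M.ret x * (1 - α) * a) ∂M.shockLaw
        ≤ M.marg a) ∧
    ∃ n : ℕ, ((1 - α : ℝ≥0) : ℝ≥0∞) ^ n *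
      ∫⁻ w, ∏ i ∈ Finset.range n, (M.ret (w i) : ℝ≥0∞) ∂M.seqLaw < 1
  /-- `sup_{t ≥ 1} E Y_t < ∞` -/
  income_bounded : (⨆ t : ℕ, ∫⁻ w, (M.inc (w t) : ℝ≥0∞) ∂M.seqLaw) < ⊤
  /-- `s ↦ (u')⁻¹(β E R u'(c(R s + Y, z)))` is concave on `[0, ∞)` for every candidate policy `c`
  that is concave in wealth. The argument of `(u')⁻¹` is `0` for all `s` or for no `s`, and in
  the former case the map is a constant. -/
  concave : ∀ c : ℝ≥0 × Z → ℝ≥0, M.Candidate c →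
    (∀ z, ConcaveOn ℝ≥0 (Set.Ioi 0) fun a => c (a, z)) →
    ConcaveOn ℝ≥0 Set.univ fun s : ℝ≥0 => Function.invFun M.marg
      ((M.β : ℝ≥0∞) *
        ∫⁻ x, (M.ret x : ℝ≥0∞) * M.marg (c (M.ret x * s + M.inc x, x.1)) ∂M.shockLaw)

/-- Next period's wealth under a policy `c` that depends on wealth only. -/
def nextAsset (c : ℝ≥0 → ℝ≥0) (a : ℝ≥0) (x : Z × E × F) : ℝ≥0 :=
  M.ret x * (a - c a) + M.inc x

lemma measurable_nextAsset {c : ℝ≥0 → ℝ≥0} (hc : Measurable c) :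
    Measurable fun p : ℝ≥0 × (Z × E × F) => M.nextAsset c p.1 p.2 :=
  ((M.measurable_ret.comp measurable_snd).mul
    (measurable_fst.sub (hc.comp measurable_fst))).add (M.measurable_inc.comp measurable_snd)

/-- The stochastic kernel `Q` of the wealth process: `Q(a, ·)` is the law of `R (a - c(a)) + Y`. -/
def assetKernel {c : ℝ≥0 → ℝ≥0} (hc : Measurable c) : Kernel ℝ≥0 ℝ≥0 where
  toFun a := M.shockLaw.map (M.nextAsset c a)
  measurable' := by
    refine Measure.measurable_of_measurable_coe _ fun B hB => ?_
    have h (a : ℝ≥0) : M.shockLaw.map (M.nextAsset c a) B =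
        M.shockLaw (Prod.mk a ⁻¹' ((fun p : ℝ≥0 × (Z × E × F) => M.nextAsset c p.1 p.2) ⁻¹' B)) :=
      Measure.map_apply ((M.measurable_nextAsset hc).comp measurable_prodMk_left) hB
    simp_rw [h]
    exact measurable_measure_prodMk_left (M.measurable_nextAsset hc hB)

/-- `a` is the wealth process under policy `c` with initial distribution `μ₀`, defined on a
probability space `(Ω, P)` and driven by iid shocks; `x t` is the shock `(z, ζ, η)` of
period `t + 1`. -/
structure IsWealthPath (c : ℝ≥0 → ℝ≥0) (μ₀ : Measure ℝ≥0) {Ω : Type*} [MeasurableSpace Ω]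
    (P : Measure Ω) (x : ℕ → Ω → Z × E × F) (a : ℕ → Ω → ℝ≥0) : Prop where
  measurable_shock : ∀ t, Measurable (x t)
  measurable_init : Measurable (a 0)
  law_shock : ∀ t, P.map (x t) = M.shockLaw
  law_init : P.map (a 0) = μ₀
  indep_shock : iIndepFun x P
  indep_init : IndepFun (a 0) (fun ω t => x t ω) P
  step : ∀ t ω, a (t + 1) ω = M.nextAsset c (a t ω) (x t ω)

end IncomeFluctuation

/-- The linear span of the increasing `ψ`-integrable functions `ℝ₊ → ℝ`. -/
def increasingSpan (ψ : Measure ℝ≥0) : Submodule ℝ (ℝ≥0 → ℝ) :=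
  Submodule.span ℝ {h | Monotone h ∧ Integrable h ψ}

end

/-! The optimal policy comes from the Euler equation. A marginal value of savings `g` determines
savings at wealth `a` as the largest `s` with `u'(a - s) ≤ g s` (`sav`). The map sending `g` to the
expected discounted marginal utility of the resulting consumption is monotone on `[0, ∞]`-valued
functions, so it has a least fixed point (`margValStar`). Leastness turns every prefixed point into
a bound: a constant gives finiteness, hence continuity by dominated convergence, and `u'(α s / (1 -
α))` gives consumption of at least `α a`. This produces an `EulerPolicy`.

Optimality is verified directly. Concavity of `u` and the Euler equation give a finite-horizon
comparison with any feasible policy, with a remainder that vanishes (`EulerPolicy.comparison`).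
Strict concavity makes domination strict wherever the two policies differ, which gives uniqueness.

For the dynamics, `(1 - α) E R < 1` keeps mean wealth bounded, and the monotone backward iterates
from zero wealth converge to a random variable with stationary law. If savings stayed positive with
certainty, the Euler equation would iterate to `u'(c(a)) ≤ (β E R)^n g(0)`, which fails for large
`n` because `β E R < 1`. Hence savings vanish at some time almost surely. At that time all paths
from lower initial wealth also save nothing, and they all receive the same income next period: paths
driven by the same shocks merge (`EulerPolicy.coalescing`).

Merging yields the rest. It makes boundedness of the partial sums a shift-invariant event, so it has
probability zero or one. The maximal ergodic theorem then gives the law of large numbers from a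
stationary start, and merging carries it to every start. Two stationary laws give the same limiting
frequencies, so they coincide. Frequencies of countably many open sets give weak convergence on a
single event of full probability. -/

/-! ### Sequences of independent, identically distributed shocks -/

section IIDSequence

variable {S : Type*}

/-- Prepend an entry to a sequence. -/
def seqCons (x : S) (w : ℕ → S) : ℕ → S
  | 0 => x
  | n + 1 => w n

/-- Drop the first entry of a sequence. -/
def seqShift (w : ℕ → S) : ℕ → S := fun n => w (n + 1)

@[simp] lemma seqShift_seqCons (x : S) (w : ℕ → S) : seqShift (seqCons x w) = w := rfl

@[simp] lemma seqCons_zero (x : S) (w : ℕ → S) : seqCons x w 0 = x := rfl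

@[simp] lemma seqCons_succ (x : S) (w : ℕ → S) (n : ℕ) : seqCons x w (n + 1) = w n := rfl

lemma iterate_seqShift (n : ℕ) (w : ℕ → S) : seqShift^[n] w = fun i => w (n + i) := by
  induction n generalizing w with
  | zero => simp
  | succ n ih =>
    rw [Function.iterate_succ_apply, ih]
    funext i
    simp only [seqShift]
    congr 1
    omega

variable [MeasurableSpace S] (ν : Measure S) [IsProbabilityMeasure ν]

lemma measurable_seqCons : Measurable fun p : S × (ℕ → S) => seqCons p.1 p.2 := by
  refine measurable_pi_lambda _ fun n => ?_
  cases n with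
  | zero => exact measurable_fst
  | succ n => exact (measurable_pi_apply n).comp measurable_snd

lemma measurable_seqShift : Measurable (seqShift : (ℕ → S) → ℕ → S) :=
  measurable_pi_lambda _ fun n => measurable_pi_apply (n + 1)

lemma measurePreserving_seqCons :
    MeasurePreserving (fun p : S × (ℕ → S) => seqCons p.1 p.2)
      (ν.prod (Measure.infinitePi fun _ => ν)) (Measure.infinitePi fun _ => ν) := by
  classical
  refine ⟨measurable_seqCons, Measure.eq_infinitePi _ fun s t ht => ?_⟩
  obtain ⟨n, hn⟩ : ∃ n, s ⊆ Finset.range (n + 1) := by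
    obtain ⟨n, hn⟩ := s.exists_nat_subset_range
    exact ⟨n, hn.trans (Finset.range_mono (Nat.le_succ n))⟩
  -- Padding with `univ` makes the index set an initial segment, which splits into coordinate `0`
  -- and a shifted segment.
  set t' : ℕ → Set S := fun i => if i ∈ s then t i else Set.univ with ht'
  have hm (i : ℕ) : MeasurableSet (t' i) := by
    simp only [ht']; split_ifs; exacts [ht i, .univ]
  have hset : (fun p : S × (ℕ → S) => seqCons p.1 p.2) ⁻¹' Set.pi s t =
      t' 0 ×ˢ Set.pi (Finset.range n) fun i => t' (i + 1) := by
    ext ⟨x, w⟩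
    simp only [Set.mem_preimage, Set.mem_pi, Set.mem_prod, Finset.mem_coe, ht']
    constructor
    · intro h
      refine ⟨?_, fun i _ => ?_⟩
      · split_ifs with h0
        exacts [h 0 h0, trivial]
      · split_ifs with h0
        exacts [h (i + 1) h0, trivial]
    · rintro ⟨h0, h⟩ i hi
      cases i with
      | zero => simpa [hi] using h0
      | succ i =>
        have := h i (Finset.mem_range.2 (by have := Finset.mem_range.1 (hn hi); omega))
        simpa [hi] using this
  rw [Measure.map_apply measurable_seqCons (.pi s.countable_toSet fun i _ => ht i), hset,
    Measure.prod_prod, Measure.infinitePi_pi _ fun i _ => hm _]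
  have hprod : ∏ i ∈ s, ν (t i) = ∏ i ∈ Finset.range (n + 1), ν (t' i) := by
    rw [← Finset.prod_subset hn (f := fun i => ν (t' i))]
    · exact Finset.prod_congr rfl fun i hi => by simp [ht', hi]
    · intro i _ hi
      simp [ht', hi]
  rw [hprod, Finset.prod_range_succ', mul_comm]

lemma lintegral_infinitePi_eq_seqCons {f : (ℕ → S) → ℝ≥0∞} (hf : Measurable f) :
    ∫⁻ w, f w ∂Measure.infinitePi (fun _ => ν) =
      ∫⁻ x, ∫⁻ w, f (seqCons x w) ∂Measure.infinitePi (fun _ => ν) ∂ν := by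
  rw [← (measurePreserving_seqCons ν).lintegral_comp hf,
    lintegral_prod (fun p : S × (ℕ → S) => f (seqCons p.1 p.2))
      (hf.comp measurable_seqCons).aemeasurable]

lemma lintegral_infinitePi_eval_zero {f : S → ℝ≥0∞} (hf : Measurable f) (n : ℕ) :
    ∫⁻ w, f (w n) ∂Measure.infinitePi (fun _ : ℕ => ν) = ∫⁻ x, f x ∂ν :=
  (measurePreserving_eval_infinitePi (fun _ : ℕ => ν) n).lintegral_comp hf

lemma lintegral_infinitePi_prod_range {f : S → ℝ≥0∞} (hf : Measurable f) (n : ℕ) :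
    ∫⁻ w, ∏ i ∈ Finset.range n, f (w i) ∂Measure.infinitePi (fun _ : ℕ => ν) =
      (∫⁻ x, f x ∂ν) ^ n := by
  induction n with
  | zero => simp
  | succ n ih =>
    have hm (k : ℕ) : Measurable fun w : ℕ → S => ∏ i ∈ Finset.range k, f (w i) :=
      Finset.measurable_fun_prod _ fun i _ => hf.comp (measurable_pi_apply i)
    rw [lintegral_infinitePi_eq_seqCons ν (hm _)]
    simp_rw [Finset.prod_range_succ', seqCons_zero, seqCons_succ]
    have (x : S) : ∫⁻ w, (∏ i ∈ Finset.range n, f (w i)) * f x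
        ∂Measure.infinitePi (fun _ : ℕ => ν) = (∫⁻ x, f x ∂ν) ^ n * f x := by
      rw [lintegral_mul_const _ (hm n), ih]
    simp_rw [this]
    rw [lintegral_const_mul _ hf, pow_succ]

lemma ae_infinitePi_of_ae_seqCons {p : (ℕ → S) → Prop} (hp : MeasurableSet {w | p w})
    (h : ∀ᵐ x ∂ν, ∀ᵐ w ∂Measure.infinitePi (fun _ => ν), p (seqCons x w)) :
    ∀ᵐ w ∂Measure.infinitePi (fun _ => ν), p w := by
  rw [← (measurePreserving_seqCons ν).map_eq, ae_map_iff measurable_seqCons.aemeasurable hp]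
  exact (Measure.ae_prod_iff_ae_ae (measurable_seqCons hp)).2 h

lemma measurePreserving_seqShift :
    MeasurePreserving (seqShift : (ℕ → S) → ℕ → S)
      (Measure.infinitePi fun _ => ν) (Measure.infinitePi fun _ => ν) :=
  ⟨measurable_seqShift, Measure.map_infinitePi_infinitePi_of_inj (add_left_injective 1)⟩

/-- The one-sided Bernoulli shift is ergodic. -/
lemma ae_or_ae_not_of_ae_seqShift_iff {D : Set (ℕ → S)} (hD : MeasurableSet D)
    (h : ∀ᵐ w ∂Measure.infinitePi (fun _ => ν), w ∈ D ↔ seqShift w ∈ D) :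
    (∀ᵐ w ∂Measure.infinitePi (fun _ => ν), w ∈ D) ∨
      ∀ᵐ w ∂Measure.infinitePi (fun _ => ν), w ∉ D := by
  set P := Measure.infinitePi fun _ : ℕ => ν
  have hn : ∀ᵐ w ∂P, ∀ n : ℕ, w ∈ D ↔ seqShift^[n] w ∈ D := by
    refine ae_all_iff.2 fun n => ?_
    induction n with
    | zero => simp
    | succ n ih =>
      filter_upwards [ih, ((measurePreserving_seqShift ν).iterate n).quasiMeasurePreserving.ae h]
        with w h1 h2
      rw [h1, h2, Function.iterate_succ_apply']
  -- `D` is only almost surely invariant. The event of lying in `D` eventually differs from it by a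
  -- null set and belongs to the tail σ-algebra, so Kolmogorov's zero-one law applies.
  set D' : Set (ℕ → S) := {w | ∀ᶠ n in atTop, seqShift^[n] w ∈ D} with hD'
  have hDD' : ∀ᵐ w ∂P, w ∈ D ↔ w ∈ D' := by
    filter_upwards [hn] with w hw
    simp only [hD', Set.mem_ofPred_eq, ← hw, eventually_const]
  let s : ℕ → MeasurableSpace (ℕ → S) := fun n => MeasurableSpace.comap (fun w => w n) inferInstance
  have hs (n : ℕ) : s n ≤ MeasurableSpace.pi := (measurable_pi_apply n).comap_le
  have hind : iIndep s P :=
    iIndepFun_infinitePi (P := fun _ : ℕ => ν) (X := fun _ x => x) fun _ => measurable_id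
  have htail : MeasurableSet[limsup s atTop] D' := by
    rw [limsup_eq_iInf_iSup_of_nat]
    rw [MeasurableSpace.measurableSet_iInf]
    intro k
    -- Only shifts by at least `k` appear, so `D'` depends on the coordinates from `k` onwards.
    have hset : D' = ⋃ N : ℕ, ⋂ n : ℕ, seqShift^[k + N + n] ⁻¹' D := by
      ext w
      simp only [hD', Set.mem_ofPred_eq, eventually_atTop, Set.mem_iUnion, Set.mem_iInter,
        Set.mem_preimage]
      constructor
      · rintro ⟨N, hN⟩
        exact ⟨N, fun n => hN _ (by omega)⟩
      · rintro ⟨N, hN⟩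
        refine ⟨k + N, fun n hn => ?_⟩
        obtain ⟨j, rfl⟩ := Nat.exists_eq_add_of_le hn
        exact hN j
    rw [hset]
    refine MeasurableSet.iUnion fun N => MeasurableSet.iInter fun n => ?_
    have hmeas : Measurable[⨆ i, ⨆ (_ : i ≥ k), s i] (seqShift^[k + N + n] : (ℕ → S) → ℕ → S) := by
      refine @measurable_pi_lambda _ _ _ (_) _ _ fun i => ?_
      simp only [iterate_seqShift]
      refine Measurable.mono (comap_measurable (fun w : ℕ → S => w (k + N + n + i))) ?_ le_rfl
      exact le_iSup₂_of_le (f := fun i (_ : i ≥ k) => s i) (k + N + n + i) (by omega) le_rfl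
    exact hmeas hD
  have hD'm : MeasurableSet D' := by
    have : limsup s atTop ≤ MeasurableSpace.pi := by
      rw [limsup_eq_iInf_iSup_of_nat]
      exact (iInf_le _ 0).trans (iSup₂_le fun i _ => hs i)
    exact this _ htail
  rcases measure_zero_or_one_of_measurableSet_limsup_atTop hs hind htail with h0 | h1
  · right
    filter_upwards [hDD', measure_eq_zero_iff_ae_notMem.1 h0] with w h1 h2
    rwa [h1]
  · left
    filter_upwards [hDD', (mem_ae_iff_prob_eq_one hD'm).2 h1] with w h1 h2
    rwa [h1]

end IIDSequence

/-! ### The pointwise ergodic theorem -/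

section Ergodic

variable {X : Type*}

/-- `max_{0 ≤ k ≤ n} S_k g`, where `S_k g` are the Birkhoff sums. -/
def birkhoffMax (T : X → X) (g : X → ℝ) : ℕ → X → ℝ
  | 0 => fun _ => 0
  | n + 1 => fun x => max 0 (g x + birkhoffMax T g n (T x))

lemma birkhoffMax_nonneg (T : X → X) (g : X → ℝ) (n : ℕ) (x : X) : 0 ≤ birkhoffMax T g n x := by
  cases n with
  | zero => exact le_rfl
  | succ n => exact le_max_left _ _

lemma birkhoffMax_le_succ (T : X → X) (g : X → ℝ) (n : ℕ) (x : X) :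
    birkhoffMax T g n x ≤ birkhoffMax T g (n + 1) x := by
  induction n generalizing x with
  | zero => exact birkhoffMax_nonneg T g 1 x
  | succ n ih => exact max_le_max le_rfl (by gcongr; exact ih _)

lemma birkhoffSum_le_birkhoffMax (T : X → X) (g : X → ℝ) (n : ℕ) (x : X) :
    birkhoffSum T g n x ≤ birkhoffMax T g n x := by
  induction n generalizing x with
  | zero => simp [birkhoffMax]
  | succ n ih =>
    rw [birkhoffSum_succ']
    exact le_max_of_le_right (by gcongr; exact ih _)

variable [MeasurableSpace X] {P : Measure X} {T : X → X}

lemma integrable_birkhoffMax (hT : MeasurePreserving T P P) {g : X → ℝ}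
    (hg : Integrable g P) (n : ℕ) : Integrable (birkhoffMax T g n) P := by
  induction n with
  | zero => exact integrable_zero _ _ _
  | succ n ih =>
    exact (integrable_zero _ _ _).sup (hg.add (hT.integrable_comp_of_integrable ih))

/-- A form of the maximal ergodic theorem. -/
lemma integral_nonneg_of_ae_not_bddAbove_birkhoffSum (hT : MeasurePreserving T P P)
    {g : X → ℝ} (hg : Integrable g P)
    (h : ∀ᵐ x ∂P, ¬ BddAbove (Set.range fun n => birkhoffSum T g n x)) :
    0 ≤ ∫ x, g x ∂P := by
  -- The left side has nonnegative integral, since `T` preserves `P` and the maxima increase in `n`.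
  -- Where the sums are unbounded above, the right side eventually equals `g x`. Dominated
  -- convergence with majorant `|g|` then concludes.
  have hid (n : ℕ) (x : X) : birkhoffMax T g (n + 1) x - birkhoffMax T g n (T x) =
      max (-birkhoffMax T g n (T x)) (g x) := by
    simp only [birkhoffMax]
    rw [← max_sub_sub_right]
    congr 1 <;> ring
  have hint (n : ℕ) := integrable_birkhoffMax hT hg n
  have hintT (n : ℕ) : Integrable (fun x => birkhoffMax T g n (T x)) P :=
    hT.integrable_comp_of_integrable (hint n)
  have hpos (n : ℕ) : 0 ≤ ∫ x, max (-birkhoffMax T g n (T x)) (g x) ∂P := by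
    simp_rw [← hid]
    rw [integral_sub (hint _) (hintT _)]
    have hcomp : ∫ x, birkhoffMax T g n (T x) ∂P = ∫ x, birkhoffMax T g n x ∂P := by
      conv_rhs => rw [← hT.map_eq]
      rw [integral_map hT.measurable.aemeasurable]
      rw [hT.map_eq]
      exact (hint n).aestronglyMeasurable
    rw [hcomp, sub_nonneg]
    exact integral_mono (hint _) (hint _) (birkhoffMax_le_succ T g n)
  refine ge_of_tendsto' (tendsto_integral_of_dominated_convergence (fun x => ‖g x‖)
    (F := fun n x => max (-birkhoffMax T g n (T x)) (g x)) (fun n => ?_) hg.norm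
    (fun n => ?_) ?_) hpos
  · exact ((hintT n).neg.sup hg).aestronglyMeasurable
  · refine .of_forall fun x => ?_
    have := birkhoffMax_nonneg T g n (T x)
    rw [Real.norm_eq_abs, Real.norm_eq_abs, abs_le]
    constructor
    · exact le_max_of_le_right (neg_abs_le _)
    · exact max_le (by linarith [abs_nonneg (g x)]) (le_abs_self _)
  · filter_upwards [h] with x hx
    have hmono : Monotone fun n => birkhoffMax T g n (T x) :=
      monotone_nat_of_le_succ fun n => birkhoffMax_le_succ T g n _
    obtain ⟨N, hN⟩ : ∃ N, -g x ≤ birkhoffMax T g N (T x) := by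
      by_contra! hcon
      refine hx ⟨0, ?_⟩
      rintro _ ⟨n, rfl⟩
      cases n with
      | zero => simp
      | succ n =>
        have h1 := birkhoffSum_le_birkhoffMax T g n (T x)
        have h2 := hcon n
        simp only [birkhoffSum_succ']
        linarith
    refine tendsto_const_nhds.congr' ?_
    filter_upwards [eventually_ge_atTop N] with n hn
    rw [max_eq_right]
    linarith [hmono hn]

/-- The pointwise ergodic theorem, under the zero-one property of the events that the Birkhoff sums
of an affine function of `f` are bounded above. -/
theorem tendsto_birkhoffSum_div_of_zero_one [IsProbabilityMeasure P]
    (hT : MeasurePreserving T P P) {f : X → ℝ} (hf : Integrable f P)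
    (h01 : ∀ k b : ℝ,
      (∀ᵐ x ∂P, BddAbove (Set.range fun n => birkhoffSum T (fun y => k * f y + b) n x)) ∨
      ∀ᵐ x ∂P, ¬ BddAbove (Set.range fun n => birkhoffSum T (fun y => k * f y + b) n x)) :
    ∀ᵐ x ∂P, Tendsto (fun n : ℕ => (1 / (n : ℝ)) * birkhoffSum T f n x) atTop
      (𝓝 (∫ x, f x ∂P)) := by
  -- A negative mean rules out almost sure unboundedness by the maximal theorem, so the zero-one
  -- alternative leaves boundedness.
  have key (k b : ℝ) (hb : k * ∫ x, f x ∂P + b < 0) :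
      ∀ᵐ x ∂P, BddAbove (Set.range fun n => birkhoffSum T (fun y => k * f y + b) n x) := by
    refine (h01 k b).resolve_right fun h => ?_
    have := integral_nonneg_of_ae_not_bddAbove_birkhoffSum hT
      ((hf.const_mul k).add (integrable_const b)) h
    simp only [Pi.add_apply] at this
    rw [integral_add (hf.const_mul k) (integrable_const b), integral_const_mul] at this
    simp only [integral_const, probReal_univ, one_smul] at this
    linarith
  have hsum (k b : ℝ) (n : ℕ) (x : X) : birkhoffSum T (fun y => k * f y + b) n x =
      k * birkhoffSum T f n x + n * b := by
    simp [birkhoffSum, Finset.sum_add_distrib, Finset.mul_sum]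
  set I := ∫ x, f x ∂P with hI
  -- Boundedness of the sums of `f - I - 1/(j+1)` and of `-f + I - 1/(j+1)` confines the averages to
  -- within `1/(j+1)` of `I`, up to a term of order `1/n`.
  have hup : ∀ᵐ x ∂P, ∀ j : ℕ,
      BddAbove (Set.range fun n => birkhoffSum T (fun y => 1 * f y + (-I - 1 / (j + 1))) n x) ∧
      BddAbove (Set.range fun n =>
        birkhoffSum T (fun y => (-1) * f y + (I - 1 / (j + 1))) n x) := by
    refine ae_all_iff.2 fun j => ?_
    have : (0 : ℝ) < 1 / (j + 1) := by positivity
    exact (key _ _ (by linarith)).and (key _ _ (by linarith))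
  filter_upwards [hup] with x hx
  rw [Metric.tendsto_atTop]
  intro ε hε
  obtain ⟨j, hj⟩ := exists_nat_one_div_lt (half_pos hε)
  obtain ⟨⟨B, hB⟩, ⟨B', hB'⟩⟩ := hx j
  obtain ⟨N, hN⟩ := exists_nat_gt ((|B| + |B'|) / (ε / 2))
  refine ⟨N + 1, fun n hn => ?_⟩
  have hn0 : (0 : ℝ) < n := by exact_mod_cast (by omega : 0 < n)
  have hnN : (|B| + |B'|) < n * (ε / 2) := by
    rw [div_lt_iff₀ (by positivity)] at hN
    have : (N : ℝ) ≤ n := by exact_mod_cast (by omega : N ≤ n)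
    nlinarith
  have h1 : _ ≤ B := hB ⟨n, rfl⟩
  have h2 : _ ≤ B' := hB' ⟨n, rfl⟩
  simp only [hsum] at h1 h2
  have hjn : (n : ℝ) * (1 / ((j : ℝ) + 1)) < n * (ε / 2) := by gcongr
  have e : 1 / (n : ℝ) * birkhoffSum T f n x - I = (birkhoffSum T f n x - n * I) / n := by
    field_simp
  rw [Real.dist_eq, e, abs_div, abs_of_pos hn0, div_lt_iff₀ hn0, abs_lt]
  constructor <;> nlinarith [le_abs_self B, le_abs_self B', abs_nonneg B, abs_nonneg B']

end Ergodic

/-! ### Averages along sequences that eventually agree -/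

section Averages

lemma exists_sum_range_eq_add_of_eventuallyEq {x y : ℕ → ℝ} (h : ∀ᶠ t in atTop, x t = y t) :
    ∃ C : ℝ, ∀ᶠ n in atTop, ∑ t ∈ Finset.range n, x t = ∑ t ∈ Finset.range n, y t + C := by
  obtain ⟨N, hN⟩ := eventually_atTop.1 h
  refine ⟨∑ t ∈ Finset.range N, x t - ∑ t ∈ Finset.range N, y t,
    eventually_atTop.2 ⟨N, fun n hn => ?_⟩⟩
  induction n, hn using Nat.le_induction with
  | base => ring
  | succ n hn ih => rw [Finset.sum_range_succ, Finset.sum_range_succ, ih, hN n hn]; ring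

lemma bddAbove_range_of_eventually_le {x : ℕ → ℝ} {B : ℝ} (h : ∀ᶠ n in atTop, x n ≤ B) :
    BddAbove (Set.range x) := by
  have : IsBoundedUnder (· ≤ ·) atTop x := ⟨B, by simpa using h⟩
  exact this.bddAbove_range

lemma bddAbove_sum_range_of_eventuallyEq {x y : ℕ → ℝ} (h : ∀ᶠ t in atTop, x t = y t)
    (hx : BddAbove (Set.range fun n => ∑ t ∈ Finset.range n, x t)) :
    BddAbove (Set.range fun n => ∑ t ∈ Finset.range n, y t) := by
  obtain ⟨C, hC⟩ := exists_sum_range_eq_add_of_eventuallyEq h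
  obtain ⟨B, hB⟩ := hx
  refine bddAbove_range_of_eventually_le (B := B - C) ?_
  filter_upwards [hC] with n hn
  have : _ ≤ B := hB ⟨n, rfl⟩
  simp only at this
  linarith

lemma bddAbove_sum_range_iff_of_eventuallyEq {x y : ℕ → ℝ} (h : ∀ᶠ t in atTop, x t = y t) :
    BddAbove (Set.range fun n => ∑ t ∈ Finset.range n, x t) ↔
      BddAbove (Set.range fun n => ∑ t ∈ Finset.range n, y t) :=
  ⟨bddAbove_sum_range_of_eventuallyEq h,
    bddAbove_sum_range_of_eventuallyEq (h.mono fun _ ht => ht.symm)⟩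

lemma bddAbove_sum_range_succ_iff (x : ℕ → ℝ) :
    BddAbove (Set.range fun n => ∑ t ∈ Finset.range n, x t) ↔
      BddAbove (Set.range fun n => ∑ t ∈ Finset.range n, x (t + 1)) := by
  constructor
  · rintro ⟨B, hB⟩
    refine ⟨B - x 0, ?_⟩
    rintro _ ⟨n, rfl⟩
    have : _ ≤ B := hB ⟨n + 1, rfl⟩
    simp only [Finset.sum_range_succ'] at this
    simp only
    linarith
  · rintro ⟨B, hB⟩
    refine bddAbove_range_of_eventually_le (B := B + x 0) ?_
    filter_upwards [eventually_ge_atTop 1] with n hn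
    obtain ⟨k, rfl⟩ := Nat.exists_eq_add_of_le' hn
    have : _ ≤ B := hB ⟨k, rfl⟩
    simp only at this
    rw [Finset.sum_range_succ']
    linarith

lemma tendsto_average_of_eventuallyEq {x y : ℕ → ℝ} {l : ℝ} (h : ∀ᶠ t in atTop, x t = y t)
    (hx : Tendsto (fun n : ℕ => (1 / (n : ℝ)) * ∑ t ∈ Finset.range n, x t) atTop (𝓝 l)) :
    Tendsto (fun n : ℕ => (1 / (n : ℝ)) * ∑ t ∈ Finset.range n, y t) atTop (𝓝 l) := by
  obtain ⟨C, hC⟩ := exists_sum_range_eq_add_of_eventuallyEq h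
  have h0 : Tendsto (fun n : ℕ => (1 / (n : ℝ)) * C) atTop (𝓝 (0 * C)) :=
    tendsto_one_div_atTop_nhds_zero_nat.mul_const C
  have := hx.sub h0
  rw [zero_mul, sub_zero] at this
  refine this.congr' ?_
  filter_upwards [hC] with n hn
  rw [hn]
  ring

lemma sum_Icc_one_eq_sum_range (x : ℕ → ℝ) (n : ℕ) :
    ∑ t ∈ Finset.Icc 1 n, x t = ∑ t ∈ Finset.range n, x (t + 1) := by
  rw [Finset.sum_bij (fun t _ => t - 1)]
  · intro t ht
    simp only [Finset.mem_Icc, Finset.mem_range] at ht ⊢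
    omega
  · intro t ht s hs hts
    simp only [Finset.mem_Icc] at ht hs
    omega
  · intro t ht
    exact ⟨t + 1, by simpa using ht, by simp⟩
  · intro t ht
    simp only [Finset.mem_Icc] at ht
    congr 1
    omega

/-- Finite unions of elements of a countable basis. -/
def finiteUnionsOfBasis (X : Type*) [TopologicalSpace X] [SecondCountableTopology X] :
    Set (Set X) :=
  Set.sUnion '' {s : Set (Set X) | s.Finite ∧ s ⊆ TopologicalSpace.countableBasis X}

lemma countable_finiteUnionsOfBasis (X : Type*) [TopologicalSpace X] [SecondCountableTopology X] :
    (finiteUnionsOfBasis X).Countable :=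
  (Set.countable_ofPred_finite_subset (TopologicalSpace.countable_countableBasis X)).image _

lemma isOpen_of_mem_finiteUnionsOfBasis {X : Type*} [TopologicalSpace X]
    [SecondCountableTopology X] {U : Set X} (hU : U ∈ finiteUnionsOfBasis X) : IsOpen U := by
  obtain ⟨s, hs, rfl⟩ := hU
  exact isOpen_sUnion fun V hV =>
    (TopologicalSpace.isBasis_countableBasis X).isOpen (hs.2 hV)

/-- Every open set has measure arbitrarily well approximated from inside by finite unions of
elements of a countable basis. -/
lemma exists_mem_finiteUnionsOfBasis_lt_measure {X : Type*} [TopologicalSpace X]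
    [SecondCountableTopology X] [MeasurableSpace X] (ψ : Measure X)
    {G : Set X} (hG : IsOpen G) {r : ℝ≥0∞} (hr : r < ψ G) :
    ∃ U ∈ finiteUnionsOfBasis X, U ⊆ G ∧ r < ψ U := by
  set 𝒮 := {V ∈ TopologicalSpace.countableBasis X | V ⊆ G} with h𝒮
  have hc : 𝒮.Countable := (TopologicalSpace.countable_countableBasis X).mono (Set.sep_subset _ _)
  have hGu : G = ⋃₀ 𝒮 :=
    (TopologicalSpace.isBasis_countableBasis X).open_eq_sUnion' hG
  have hdir : ψ (⋃₀ 𝒮) = ⨆ t : {t : Set (Set X) // t.Finite ∧ t ⊆ 𝒮}, ψ (⋃₀ t.1) := by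
    have : Countable {t : Set (Set X) // t.Finite ∧ t ⊆ 𝒮} :=
      (Set.countable_ofPred_finite_subset hc).to_subtype
    rw [← Directed.measure_iUnion]
    · congr 1
      ext x
      simp only [Set.mem_sUnion, Set.mem_iUnion, Subtype.exists, exists_prop]
      constructor
      · rintro ⟨V, hV, hx⟩
        exact ⟨{V}, ⟨Set.finite_singleton V, by simpa using hV⟩, V, rfl, hx⟩
      · rintro ⟨t, ⟨-, ht⟩, V, hV, hx⟩
        exact ⟨V, ht hV, hx⟩
    · rintro ⟨t, ht, ht'⟩ ⟨s, hs, hs'⟩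
      exact ⟨⟨t ∪ s, ht.union hs, Set.union_subset ht' hs'⟩,
        Set.sUnion_subset_sUnion Set.subset_union_left,
        Set.sUnion_subset_sUnion Set.subset_union_right⟩
  rw [hGu, hdir, lt_iSup_iff] at hr
  obtain ⟨⟨t, ht, ht'⟩, hlt⟩ := hr
  exact ⟨⋃₀ t, ⟨t, ⟨ht, fun V hV => (ht' hV).1⟩, rfl⟩,
    Set.sUnion_subset fun V hV => (ht' hV).2, hlt⟩

/-- Convergence of the empirical frequencies of countably many open sets implies weak convergence
of the empirical distributions. -/
theorem tendsto_average_of_tendsto_frequency {X : Type*} [TopologicalSpace X]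
    [SecondCountableTopology X] [MeasurableSpace X] [BorelSpace X] (ψ : Measure X)
    [IsProbabilityMeasure ψ] {y : ℕ → X}
    (hy : ∀ U ∈ finiteUnionsOfBasis X, Tendsto (fun n : ℕ => (1 / (n : ℝ)) *
      ∑ t ∈ Finset.range n, U.indicator (fun _ => (1 : ℝ)) (y t)) atTop (𝓝 (ψ.real U)))
    (h : X →ᵇ ℝ) :
    Tendsto (fun n : ℕ => (1 / (n : ℝ)) * ∑ t ∈ Finset.range n, h (y t)) atTop
      (𝓝 (∫ x, h x ∂ψ)) := by
  -- The index is shifted by one so that every `e n` is a probability measure.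
  let e : ℕ → Measure X := fun n =>
    ((n + 1 : ℕ) : ℝ≥0∞)⁻¹ • ∑ t ∈ Finset.range (n + 1), Measure.dirac (y t)
  have hprob (n : ℕ) : IsProbabilityMeasure (e n) := by
    refine ⟨?_⟩
    simp only [e, Measure.smul_apply, Measure.finsetSum_apply, measure_univ, Finset.sum_const,
      Finset.card_range, nsmul_eq_mul, mul_one, smul_eq_mul]
    exact ENNReal.inv_mul_cancel (by simp) (ENNReal.natCast_ne_top _)
  have hint (n : ℕ) (φ : X → ℝ) (hφ : Measurable φ) : ∫ x, φ x ∂e n =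
      (1 / ((n + 1 : ℕ) : ℝ)) * ∑ t ∈ Finset.range (n + 1), φ (y t) := by
    simp only [e]
    rw [integral_smul_measure, integral_finsetSum_measure]
    · simp only [integral_dirac' _ _ hφ.stronglyMeasurable]
      rw [ENNReal.toReal_inv, ENNReal.toReal_natCast, smul_eq_mul, one_div]
    · intro i _
      exact integrable_dirac' hφ.stronglyMeasurable (by simp)
  have hreal (n : ℕ) (U : Set X) (hU : MeasurableSet U) : (e n).real U =
      (1 / ((n + 1 : ℕ) : ℝ)) *
        ∑ t ∈ Finset.range (n + 1), U.indicator (fun _ => (1 : ℝ)) (y t) := by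
    rw [← hint n _ (measurable_const.indicator hU), integral_indicator_const _ hU]
    simp
  have hfreq (U : Set X) (hU : U ∈ finiteUnionsOfBasis X) :
      Tendsto (fun n => e n U) atTop (𝓝 (ψ U)) := by
    have hUm := (isOpen_of_mem_finiteUnionsOfBasis hU).measurableSet
    have h1 : Tendsto (fun n => (e n).real U) atTop (𝓝 (ψ.real U)) := by
      simp_rw [hreal _ _ hUm]
      exact (tendsto_add_atTop_iff_nat 1).2 (hy U hU)
    have h2 := ENNReal.tendsto_ofReal h1
    simpa [ofReal_measureReal] using h2
  let e' : ℕ → ProbabilityMeasure X := fun n => ⟨e n, hprob n⟩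
  let ψ' : ProbabilityMeasure X := ⟨ψ, inferInstance⟩
  have hweak : Tendsto e' atTop (𝓝 ψ') := by
    -- By the portmanteau theorem it suffices to bound the lower limit on an open `G`, which is done
    -- by a finite union of basic sets inside `G` carrying nearly all its mass.
    refine tendsto_of_forall_isOpen_le_liminf_nat' fun G hG => ?_
    refine le_of_forall_lt fun r hr => ?_
    obtain ⟨U, hU, hUG, hrU⟩ := exists_mem_finiteUnionsOfBasis_lt_measure ψ hG hr
    refine hrU.trans_le ?_
    rw [← (hfreq U hU).liminf_eq]
    exact liminf_le_liminf (.of_forall fun n => measure_mono hUG)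
  have h3 := ProbabilityMeasure.tendsto_iff_forall_integral_tendsto.1 hweak h
  refine (tendsto_add_atTop_iff_nat 1).1 ?_
  refine h3.congr fun n => ?_
  exact hint n _ h.continuous.measurable

end Averages

/-! ### Iterated random functions -/

section RandomIteration

variable {X S : Type*}

/-- The path generated by the recursion `a_{t+1} = f(a_t, w_t)`. -/
def iterPath (f : X → S → X) (a : X) (w : ℕ → S) : ℕ → X
  | 0 => a
  | t + 1 => f (iterPath f a w t) (w t)

/-- Unrolls the recursion at the first shock instead of the last, as needed for conditioning on that
shock. -/
lemma iterPath_succ' (f : X → S → X) (a : X) (w : ℕ → S) (t : ℕ) :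
    iterPath f a w (t + 1) = iterPath f (f a (w 0)) (seqShift w) t := by
  induction t with
  | zero => rfl
  | succ t ih => rw [iterPath, ih]; rfl

/-- The skew product over the shift. -/
def skewProd (f : X → S → X) (p : X × (ℕ → S)) : X × (ℕ → S) := (f p.1 (p.2 0), seqShift p.2)

lemma iterate_skewProd (f : X → S → X) (t : ℕ) (p : X × (ℕ → S)) :
    (skewProd f)^[t] p = (iterPath f p.1 p.2 t, seqShift^[t] p.2) := by
  induction t generalizing p with
  | zero => rfl
  | succ t ih => rw [Function.iterate_succ_apply, ih, iterPath_succ']; rfl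

variable [MeasurableSpace X] [MeasurableSpace S] {f : X → S → X}

lemma measurable_iterPath (hf : Measurable fun p : X × S => f p.1 p.2) (t : ℕ) :
    Measurable fun p : X × (ℕ → S) => iterPath f p.1 p.2 t := by
  induction t with
  | zero => exact measurable_fst
  | succ t ih => exact hf.comp (ih.prodMk ((measurable_pi_apply t).comp measurable_snd))

lemma measurable_iterPath_right (hf : Measurable fun p : X × S => f p.1 p.2) (a : X) (t : ℕ) :
    Measurable fun w : ℕ → S => iterPath f a w t :=
  (measurable_iterPath hf t).comp measurable_prodMk_left

variable (ν : Measure S) [IsProbabilityMeasure ν]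

/-- Once the sequence is split into its first shock and the rest, the skew product applies `f` to
state and first shock and leaves the rest untouched. Stationarity of `ψ` is then all that is needed.
-/
lemma measurePreserving_skewProd (hf : Measurable fun p : X × S => f p.1 p.2)
    {ψ : Measure X} [IsProbabilityMeasure ψ]
    (hψ : (ψ.prod ν).map (fun p => f p.1 p.2) = ψ) :
    MeasurePreserving (skewProd f) (ψ.prod (Measure.infinitePi fun _ => ν))
      (ψ.prod (Measure.infinitePi fun _ => ν)) := by
  set P := Measure.infinitePi fun _ : ℕ => ν
  have hskew : Measurable (skewProd f) :=
    (hf.comp (measurable_fst.prodMk ((measurable_pi_apply 0).comp measurable_snd))).prodMk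
      (measurable_seqShift.comp measurable_snd)
  have h1 : MeasurePreserving (Prod.map id fun p : S × (ℕ → S) => seqCons p.1 p.2)
      (ψ.prod (ν.prod P)) (ψ.prod P) :=
    (MeasurePreserving.id ψ).prod (measurePreserving_seqCons ν)
  have h2 : MeasurePreserving (Prod.map (fun p : X × S => f p.1 p.2) (id : (ℕ → S) → ℕ → S))
      ((ψ.prod ν).prod P) (ψ.prod P) :=
    MeasurePreserving.prod ⟨hf, hψ⟩ (MeasurePreserving.id P)
  have h3 : MeasurePreserving (MeasurableEquiv.prodAssoc (α := X) (β := S) (γ := ℕ → S))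
      ((ψ.prod ν).prod P) (ψ.prod (ν.prod P)) := measurePreserving_prodAssoc ψ ν P
  refine ⟨hskew, ?_⟩
  conv_lhs => rw [← (h1.comp h3).map_eq]
  rw [Measure.map_map hskew (h1.comp h3).measurable]
  exact h2.map_eq

/-- Almost surely, any two paths driven by the same shocks eventually coincide. -/
def Coalescing (f : X → S → X) (ν : Measure S) [IsProbabilityMeasure ν] : Prop :=
  ∀ a b, ∀ᵐ w ∂Measure.infinitePi (fun _ : ℕ => ν),
    ∀ᶠ t in atTop, iterPath f a w t = iterPath f b w t

lemma measurableSet_bddAbove_sum_iterPath (hf : Measurable fun p : X × S => f p.1 p.2)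
    {h : X → ℝ} (hh : Measurable h) :
    MeasurableSet {p : X × (ℕ → S) |
      BddAbove (Set.range fun n => ∑ t ∈ Finset.range n, h (iterPath f p.1 p.2 (t + 1)))} :=
  measurableSet_bddAbove_range fun _ => Finset.measurable_fun_sum _ fun t _ =>
    hh.comp (measurable_iterPath hf (t + 1))

/-- Zero-one law for boundedness of sums along coalescing paths. -/
lemma Coalescing.bddAbove_sum_zero_one (hc : Coalescing f ν)
    (hf : Measurable fun p : X × S => f p.1 p.2) {h : X → ℝ} (hh : Measurable h) [Nonempty X] :
    (∀ a, ∀ᵐ w ∂Measure.infinitePi (fun _ : ℕ => ν),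
      BddAbove (Set.range fun n => ∑ t ∈ Finset.range n, h (iterPath f a w (t + 1)))) ∨
    (∀ a, ∀ᵐ w ∂Measure.infinitePi (fun _ : ℕ => ν),
      ¬ BddAbove (Set.range fun n => ∑ t ∈ Finset.range n, h (iterPath f a w (t + 1)))) := by
  obtain ⟨a₀⟩ := ‹Nonempty X›
  set B : X → (ℕ → S) → Prop := fun a w =>
    BddAbove (Set.range fun n => ∑ t ∈ Finset.range n, h (iterPath f a w (t + 1))) with hB
  have hcpl (a b : X) : ∀ᵐ w ∂Measure.infinitePi (fun _ : ℕ => ν), B a w ↔ B b w := by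
    filter_upwards [hc a b] with w hw
    refine bddAbove_sum_range_iff_of_eventuallyEq ?_
    filter_upwards [(tendsto_add_atTop_nat 1).eventually hw] with t ht
    rw [ht]
  have hD : MeasurableSet {w | B a₀ w} :=
    measurable_prodMk_left (measurableSet_bddAbove_sum_iterPath hf hh)
  -- After one shock `x` the path from `a₀` is the path from `f a₀ x` under the shifted sequence,
  -- which merges with the path from `a₀`.
  have hinv : ∀ᵐ w ∂Measure.infinitePi (fun _ : ℕ => ν),
      w ∈ {w | B a₀ w} ↔ seqShift w ∈ {w | B a₀ w} := by
    refine ae_infinitePi_of_ae_seqCons ν (hD.iff (measurable_seqShift hD)) (.of_forall fun x => ?_)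
    filter_upwards [hcpl (f a₀ x) a₀] with w hw
    have hstep : B a₀ (seqCons x w) ↔ B (f a₀ x) w := by
      have hpath (t : ℕ) : iterPath f a₀ (seqCons x w) (t + 1 + 1) =
          iterPath f (f a₀ x) w (t + 1) := iterPath_succ' f a₀ (seqCons x w) (t + 1)
      simp only [hB]
      rw [bddAbove_sum_range_succ_iff]
      simp only [hpath]
    exact hstep.trans hw
  rcases ae_or_ae_not_of_ae_seqShift_iff ν hD hinv with h1 | h1
  · left
    intro a
    filter_upwards [hcpl a a₀, h1] with w hw hw'
    exact hw.2 hw'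
  · right
    intro a
    filter_upwards [hcpl a a₀, h1] with w hw hw'
    exact fun h => hw' (hw.1 h)

lemma measurableSet_tendsto_average_iterPath (hf : Measurable fun p : X × S => f p.1 p.2)
    {h : X → ℝ} (hh : Measurable h) (l : ℝ) :
    MeasurableSet {p : X × (ℕ → S) | Tendsto (fun n : ℕ => (1 / (n : ℝ)) *
      ∑ t ∈ Finset.range n, h (iterPath f p.1 p.2 (t + 1))) atTop (𝓝 l)} :=
  measurableSet_tendsto _ fun _ => (Finset.measurable_fun_sum _ fun t _ =>
    hh.comp (measurable_iterPath hf (t + 1))).const_mul _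

/-- Law of large numbers for coalescing random iterations, from every initial condition. -/
theorem Coalescing.ae_tendsto_average (hc : Coalescing f ν)
    (hf : Measurable fun p : X × S => f p.1 p.2) {ψ : Measure X} [IsProbabilityMeasure ψ]
    (hψ : (ψ.prod ν).map (fun p => f p.1 p.2) = ψ) {h : X → ℝ} (hh : Measurable h)
    (hint : Integrable h ψ) (a : X) :
    ∀ᵐ w ∂Measure.infinitePi (fun _ : ℕ => ν), Tendsto (fun n : ℕ => (1 / (n : ℝ)) *
      ∑ t ∈ Finset.range n, h (iterPath f a w (t + 1))) atTop (𝓝 (∫ y, h y ∂ψ)) := by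
  have : Nonempty X := ⟨a⟩
  set P := Measure.infinitePi fun _ : ℕ => ν
  have hT : MeasurePreserving (skewProd f) (ψ.prod P) (ψ.prod P) :=
    measurePreserving_skewProd ν hf hψ
  -- The observable is read off after one step, so the Birkhoff sums run over periods `1, ..., n`.
  have hfst : MeasurePreserving (fun p : X × (ℕ → S) => (skewProd f p).1) (ψ.prod P) ψ :=
    (measurePreserving_fst (μ := ψ) (ν := P)).comp hT
  have hF : Integrable (fun p : X × (ℕ → S) => h (skewProd f p).1) (ψ.prod P) :=
    hfst.integrable_comp_of_integrable hint
  have hsum (φ : X → ℝ) (n : ℕ) (p : X × (ℕ → S)) :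
      birkhoffSum (skewProd f) (fun p => φ (skewProd f p).1) n p =
        ∑ t ∈ Finset.range n, φ (iterPath f p.1 p.2 (t + 1)) := by
    refine Finset.sum_congr rfl fun t _ => ?_
    change φ (skewProd f ((skewProd f)^[t] p)).1 = _
    rw [← Function.iterate_succ_apply' (skewProd f), iterate_skewProd]
  have key := tendsto_birkhoffSum_div_of_zero_one hT hF fun k b => by
    have hm : Measurable fun y => k * h y + b := (hh.const_mul k).add_const b
    have hset := measurableSet_bddAbove_sum_iterPath hf hm
    simp only [fun n p => hsum (fun y => k * h y + b) n p]
    rcases hc.bddAbove_sum_zero_one ν hf hm with h1 | h1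
    · exact Or.inl ((Measure.ae_prod_iff_ae_ae hset).2 (.of_forall h1))
    · exact Or.inr ((Measure.ae_prod_iff_ae_ae hset.compl).2 (.of_forall h1))
  have hI : ∫ p, h (skewProd f p).1 ∂(ψ.prod P) = ∫ y, h y ∂ψ := by
    conv_rhs => rw [← hfst.map_eq]
    rw [integral_map hfst.measurable.aemeasurable]
    rw [hfst.map_eq]
    exact hint.aestronglyMeasurable
  simp only [hI, hsum] at key
  -- The ergodic theorem covers `ψ`-almost every start. One good start `b` suffices, since the path
  -- from `a` merges with the path from `b`.
  obtain ⟨b, hb⟩ := (Measure.ae_ae_of_ae_prod key).exists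
  filter_upwards [hb, hc b a] with w h1 h2
  refine tendsto_average_of_eventuallyEq ?_ h1
  filter_upwards [(tendsto_add_atTop_nat 1).eventually h2] with t ht
  rw [ht]

/-- A coalescing random iteration has at most one stationary distribution. -/
theorem Coalescing.stationary_unique (hc : Coalescing f ν)
    (hf : Measurable fun p : X × S => f p.1 p.2) {ψ φ : Measure X} [IsProbabilityMeasure ψ]
    [IsProbabilityMeasure φ] (hψ : (ψ.prod ν).map (fun p => f p.1 p.2) = ψ)
    (hφ : (φ.prod ν).map (fun p => f p.1 p.2) = φ) : φ = ψ := by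
  obtain ⟨a⟩ : Nonempty X := nonempty_of_isProbabilityMeasure ψ
  refine Measure.ext fun A hA => ?_
  have hm : Measurable (A.indicator fun _ => (1 : ℝ)) := measurable_const.indicator hA
  have hi (ρ : Measure X) [IsProbabilityMeasure ρ] : Integrable (A.indicator fun _ => (1 : ℝ)) ρ :=
    (integrable_const 1).indicator hA
  -- Along a single path the frequency of `A` converges to both `ψ A` and `φ A`.
  obtain ⟨w, h1, h2⟩ := ((hc.ae_tendsto_average ν hf hψ hm (hi ψ) a).and
    (hc.ae_tendsto_average ν hf hφ hm (hi φ) a)).exists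
  have := tendsto_nhds_unique h2 h1
  rw [integral_indicator_const _ hA, integral_indicator_const _ hA] at this
  simpa [measureReal_def, ENNReal.toReal_eq_toReal_iff'] using this

end RandomIteration

/-- The fixed point of `K ↦ L + ρ K` is the constant used in all the geometric bounds below. -/
lemma ENNReal.add_mul_div_one_sub {ρ : ℝ≥0∞} (hρ : ρ < 1) (L : ℝ≥0∞) :
    L + ρ * (L / (1 - ρ)) = L / (1 - ρ) := by
  have h1 : L = (1 - ρ) * (L / (1 - ρ)) :=
    (ENNReal.mul_div_cancel (tsub_pos_of_lt hρ).ne' (ENNReal.sub_ne_top ENNReal.one_ne_top)).symm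
  calc L + ρ * (L / (1 - ρ)) = (1 - ρ) * (L / (1 - ρ)) + ρ * (L / (1 - ρ)) := by rw [← h1]
    _ = L / (1 - ρ) := by rw [← add_mul, tsub_add_cancel_of_le hρ.le, one_mul]

namespace IncomeFluctuation

variable {m : ℕ} {Z : Set (EuclideanSpace ℝ (Fin m))} {E F : Type*}
  [MeasurableSpace E] [MeasurableSpace F] {M : IncomeFluctuation Z E F}

/-! ### Marginal utility -/

lemma marg_zero : M.marg 0 = ⊤ := if_pos rfl

lemma marg_of_pos {c : ℝ≥0} (hc : 0 < c) : M.marg c = ENNReal.ofReal (deriv M.uReal c) :=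
  if_neg hc.ne'

lemma marg_ne_top {c : ℝ≥0} (hc : 0 < c) : M.marg c ≠ ⊤ := by
  rw [marg_of_pos hc]; exact ENNReal.ofReal_ne_top

namespace UtilityAssumption

lemma marg_pos (hU : M.UtilityAssumption) (c : ℝ≥0) : 0 < M.marg c := by
  rcases eq_zero_or_pos c with rfl | hc
  · simp [marg_zero]
  · rw [marg_of_pos hc, ENNReal.ofReal_pos]
    exact hU.deriv_pos _ hc

lemma deriv_strictAntiOn (hU : M.UtilityAssumption) :
    StrictAntiOn (deriv M.uReal) (Set.Ioi 0) :=
  strictAntiOn_of_deriv_neg (convex_Ioi 0) hU.differentiable_deriv.continuousOn fun c hc =>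
    hU.deriv_deriv_neg c (by simpa using hc)

lemma marg_strictAnti (hU : M.UtilityAssumption) : StrictAnti M.marg := by
  intro a b hab
  have hb : 0 < b := pos_of_gt hab
  rcases eq_zero_or_pos a with rfl | ha
  · rw [marg_zero]; exact (marg_ne_top hb).lt_top
  · rw [marg_of_pos ha, marg_of_pos hb, 
      ENNReal.ofReal_lt_ofReal_iff (hU.deriv_pos _ (NNReal.coe_pos.2 ha))]
    exact hU.deriv_strictAntiOn (by simpa using ha) (by simpa using hb) (by simpa using hab)

lemma marg_antitone (hU : M.UtilityAssumption) : Antitone M.marg := hU.marg_strictAnti.antitone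

lemma measurable_marg (hU : M.UtilityAssumption) : Measurable M.marg := hU.marg_antitone.measurable

/-- At zero, where the value is `⊤`, this is the Inada condition; elsewhere `u'` is differentiable.
-/
lemma continuous_marg (hU : M.UtilityAssumption) : Continuous M.marg := by
  rw [continuous_iff_continuousAt]
  intro c
  rcases eq_zero_or_pos c with rfl | hc
  · rw [ContinuousAt, marg_zero, ENNReal.tendsto_nhds_top_iff_nnreal]
    intro y
    obtain ⟨δ, hδ, hδ'⟩ := mem_nhdsGT_iff_exists_Ioo_subset.1
      (tendsto_atTop.1 hU.tendsto_zero (y + 1))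
    have hδ0 : (0 : ℝ) < δ := hδ
    have : Set.Iio (⟨δ, hδ0.le⟩ : ℝ≥0) ∈ 𝓝 (0 : ℝ≥0) := Iio_mem_nhds (by exact_mod_cast hδ0)
    filter_upwards [this] with x hx
    rcases eq_zero_or_pos x with rfl | hx0
    · simp [marg_zero]
    · have hxδ : (x : ℝ) ∈ Set.Ioo 0 δ := ⟨by exact_mod_cast hx0, by exact_mod_cast hx⟩
      have h2 : (y : ℝ) + 1 ≤ deriv M.uReal x := hδ' hxδ
      rw [marg_of_pos hx0, ENNReal.lt_ofReal_iff_toReal_lt ENNReal.coe_ne_top,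
        ENNReal.coe_toReal]
      linarith
  · have hc' : (0 : ℝ) < c := by exact_mod_cast hc
    have h1 : ContinuousAt (deriv M.uReal) (c : ℝ) :=
      hU.differentiable_deriv.continuousOn.continuousAt (Ioi_mem_nhds hc')
    have h2 : ContinuousAt (fun x : ℝ≥0 => ENNReal.ofReal (deriv M.uReal x)) c :=
      ENNReal.continuous_ofReal.continuousAt.comp
        (h1.comp (f := fun x : ℝ≥0 => (x : ℝ)) NNReal.continuous_coe.continuousAt)
    refine h2.congr ?_
    filter_upwards [Ioi_mem_nhds hc] with x hx
    rw [marg_of_pos hx]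

end UtilityAssumption

/-! ### The savings rule induced by a marginal value of savings -/

/-- Feasible savings whose marginal cost does not exceed the marginal value `g`. -/
def savSet (M : IncomeFluctuation Z E F) (g : ℝ≥0 → ℝ≥0∞) (a : ℝ≥0) : Set ℝ≥0 :=
  {s | s ≤ a ∧ M.marg (a - s) ≤ g s}

/-- Savings at wealth `a` when the marginal value of savings is `g`. -/
noncomputable def sav (M : IncomeFluctuation Z E F) (g : ℝ≥0 → ℝ≥0∞) (a : ℝ≥0) : ℝ≥0 :=
  sSup (M.savSet g a)

/-- Consumption at wealth `a` when the marginal value of savings is `g`. -/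
noncomputable def con (M : IncomeFluctuation Z E F) (g : ℝ≥0 → ℝ≥0∞) (a : ℝ≥0) : ℝ≥0 :=
  a - M.sav g a

variable {g : ℝ≥0 → ℝ≥0∞}

lemma bddAbove_savSet (g : ℝ≥0 → ℝ≥0∞) (a : ℝ≥0) : BddAbove (M.savSet g a) := ⟨a, fun _ h => h.1⟩

lemma sav_le (g : ℝ≥0 → ℝ≥0∞) (a : ℝ≥0) : M.sav g a ≤ a := csSup_le' fun _ h => h.1

lemma con_le (g : ℝ≥0 → ℝ≥0∞) (a : ℝ≥0) : M.con g a ≤ a := tsub_le_self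

lemma sub_con (g : ℝ≥0 → ℝ≥0∞) (a : ℝ≥0) : a - M.con g a = M.sav g a :=
  tsub_tsub_cancel_of_le (sav_le g a)

/-- No regularity of `g` is needed: in `ℝ≥0` the supremum of the empty set is `0`, the corner
solution without savings. This makes time iteration order-preserving. -/
lemma sav_le_sav {g g' : ℝ≥0 → ℝ≥0∞} (h : g ≤ g') (a : ℝ≥0) : M.sav g a ≤ M.sav g' a :=
  csSup_le_csSup' (bddAbove_savSet g' a) fun s hs => ⟨hs.1, hs.2.trans (h s)⟩

lemma con_le_con {g g' : ℝ≥0 → ℝ≥0∞} (h : g ≤ g') (a : ℝ≥0) : M.con g' a ≤ M.con g a :=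
  tsub_le_tsub_left (sav_le_sav h a) a

/-- Lowering `s` lowers the marginal cost `u'(a - s)` and raises `g s`, so the admissible savings
form a down-set. -/
lemma mem_savSet_of_lt (hU : M.UtilityAssumption) (hg : Antitone g) {a s : ℝ≥0}
    (hs : s < M.sav g a) : s ∈ M.savSet g a := by
  obtain ⟨s', hs', hlt⟩ := exists_lt_of_lt_csSup' hs
  exact ⟨hlt.le.trans hs'.1,
    (hU.marg_antitone (tsub_le_tsub_left hlt.le a)).trans (hs'.2.trans (hg hlt.le))⟩

lemma monotone_sav (hU : M.UtilityAssumption) (g : ℝ≥0 → ℝ≥0∞) : Monotone (M.sav g) :=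
  fun _ b hab => csSup_le_csSup' (bddAbove_savSet g b) fun s hs =>
    ⟨hs.1.trans hab, (hU.marg_antitone (tsub_le_tsub_right hab s)).trans hs.2⟩

/-- If `r + h` is admissible at wealth `a + h`, then `r` is admissible at `a`: consumption is the
same and `g` is larger. Hence savings are 1-Lipschitz and consumption is increasing. -/
lemma sav_add_le (hg : Antitone g) (a h : ℝ≥0) : M.sav g (a + h) ≤ M.sav g a + h := by
  refine csSup_le' fun s hs => ?_
  rcases le_total s h with hsh | hsh
  · exact hsh.trans le_add_self
  · obtain ⟨r, rfl⟩ := exists_add_of_le hsh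
    have hr : r ∈ M.savSet g a := by
      refine ⟨?_, ?_⟩
      · have := hs.1
        rw [add_comm] at this
        exact le_of_add_le_add_right this
      · have h1 := hs.2
        rw [add_comm h r, add_tsub_add_eq_tsub_right] at h1
        exact h1.trans (hg le_self_add)
    rw [add_comm]
    gcongr
    exact le_csSup (bddAbove_savSet g a) hr

lemma monotone_con (hg : Antitone g) : Monotone (M.con g) := by
  intro a b hab
  obtain ⟨h, rfl⟩ := exists_add_of_le hab
  have h1 := sav_add_le (M := M) hg a h
  have h2 := sav_le (M := M) g a
  have h3 := sav_le (M := M) g (a + h)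
  simp only [con]
  rw [← NNReal.coe_le_coe, NNReal.coe_sub h2, NNReal.coe_sub h3]
  rw [← NNReal.coe_le_coe] at h1
  push_cast at h1 ⊢
  linarith

lemma continuous_sav (hU : M.UtilityAssumption) (hg : Antitone g) : Continuous (M.sav g) := by
  have hlip : LipschitzWith 1 fun a : ℝ≥0 => (M.sav g a : ℝ) := by
    refine LipschitzWith.of_le_add fun a b => ?_
    rcases le_total a b with hab | hab
    · exact (NNReal.coe_le_coe.2 (monotone_sav hU g hab)).trans (le_add_of_nonneg_right dist_nonneg)
    · obtain ⟨h, rfl⟩ := exists_add_of_le hab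
      have h1 := NNReal.coe_le_coe.2 (sav_add_le (M := M) hg b h)
      have h2 : dist (b + h) b = h := by simp [NNReal.dist_eq]
      rw [h2]
      exact_mod_cast h1
  exact NNReal.isEmbedding_coe.continuous_iff.2 hlip.continuous

lemma continuous_con (hU : M.UtilityAssumption) (hg : Antitone g) : Continuous (M.con g) :=
  continuous_id.sub (continuous_sav hU hg)

/-- Involves `g` only through `g 0` and does not require continuity, so it is available for the
fixed point before its continuity is known. -/
lemma marg_con_le (hU : M.UtilityAssumption) (hg : Antitone g) (a : ℝ≥0) :
    M.marg (M.con g a) ≤ max (M.marg a) (g 0) := by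
  rcases eq_zero_or_pos (M.sav g a) with h0 | h0
  · simp [con, h0]
  · have hcl : IsClosed {s | M.marg (a - s) ≤ g 0} :=
      isClosed_le (hU.continuous_marg.comp (continuous_const.sub continuous_id)) continuous_const
    have hsub : Set.Iio (M.sav g a) ⊆ {s | M.marg (a - s) ≤ g 0} := fun s hs =>
      (mem_savSet_of_lt hU hg hs).2.trans (hg zero_le)
    have hmem : M.sav g a ∈ closure (Set.Iio (M.sav g a)) := by
      rw [closure_Iio' (show (Set.Iio (M.sav g a)).Nonempty from ⟨0, h0⟩)]; exact Set.self_mem_Iic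
    exact le_max_of_le_right (hcl.closure_subset_iff.2 hsub hmem)

/-- Together with `le_marg_con` this is the Euler equation: the admissibility inequality extends
from all smaller `s` to the supremum by closedness. -/
lemma marg_con_le_of_sav_pos (hU : M.UtilityAssumption) (hg : Antitone g) (hgc : Continuous g)
    {a : ℝ≥0} (h0 : 0 < M.sav g a) : M.marg (M.con g a) ≤ g (M.sav g a) := by
  have hcl : IsClosed {s | M.marg (a - s) ≤ g s} :=
    isClosed_le (hU.continuous_marg.comp (continuous_const.sub continuous_id)) hgc
  have hsub : Set.Iio (M.sav g a) ⊆ {s | M.marg (a - s) ≤ g s} := fun s hs =>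
    (mem_savSet_of_lt hU hg hs).2
  have hmem : M.sav g a ∈ closure (Set.Iio (M.sav g a)) := by
    rw [closure_Iio' (show (Set.Iio (M.sav g a)).Nonempty from ⟨0, h0⟩)]; exact Set.self_mem_Iic
  exact hcl.closure_subset_iff.2 hsub hmem

/-- Savings strictly between the supremum and `a` are inadmissible, so the reverse inequality holds
there and passes to the limit. If everything is saved, marginal utility is `⊤`. -/
lemma le_marg_con (hU : M.UtilityAssumption) (hgc : Continuous g) (a : ℝ≥0) :
    g (M.sav g a) ≤ M.marg (M.con g a) := by
  rcases (sav_le (M := M) g a).eq_or_lt with h | h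
  · simp [con, h, marg_zero]
  · have hcl : IsClosed {s | g s ≤ M.marg (a - s)} :=
      isClosed_le hgc (hU.continuous_marg.comp (continuous_const.sub continuous_id))
    have hsub : Set.Ioo (M.sav g a) a ⊆ {s | g s ≤ M.marg (a - s)} := by
      intro s hs
      by_contra hcon
      exact notMem_of_csSup_lt hs.1 (bddAbove_savSet g a) ⟨hs.2.le, (not_le.1 hcon).le⟩
    have hmem : M.sav g a ∈ closure (Set.Ioo (M.sav g a) a) := by
      rw [closure_Ioo h.ne]; exact ⟨le_rfl, h.le⟩
    exact hcl.closure_subset_iff.2 hsub hmem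

/-! ### The fixed point of the Euler equation -/

/-- The expected discounted marginal utility of savings `s` when next period's consumption is
given by `c`. -/
noncomputable def margVal (M : IncomeFluctuation Z E F) (c : ℝ≥0 → ℝ≥0) (s : ℝ≥0) : ℝ≥0∞ :=
  M.β * ∫⁻ x, (M.ret x : ℝ≥0∞) * M.marg (c (M.ret x * s + M.inc x)) ∂M.shockLaw

lemma margVal_le (hU : M.UtilityAssumption) {c d : ℝ≥0 → ℝ≥0} (h : c ≤ d) (s : ℝ≥0) :
    M.margVal d s ≤ M.margVal c s := by
  unfold margVal
  gcongr with x
  exact hU.marg_antitone (h _)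

lemma antitone_margVal (hU : M.UtilityAssumption) {c : ℝ≥0 → ℝ≥0} (hc : Monotone c) :
    Antitone (M.margVal c) := by
  intro s t hst
  unfold margVal
  gcongr with x
  exact hU.marg_antitone (hc (by gcongr))

/-- Time iteration as a monotone operator on marginal values of savings. -/
noncomputable def timeIter (hU : M.UtilityAssumption) : (ℝ≥0 → ℝ≥0∞) →o (ℝ≥0 → ℝ≥0∞) where
  toFun g := M.margVal (M.con g)
  monotone' _ _ h s := margVal_le hU (fun a => con_le_con h a) s

/-- The least fixed point of time iteration. -/
noncomputable def margValStar (hU : M.UtilityAssumption) : ℝ≥0 → ℝ≥0∞ := (timeIter hU).lfp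

lemma margVal_con_margValStar (hU : M.UtilityAssumption) :
    M.margVal (M.con (margValStar hU)) = margValStar hU :=
  (timeIter hU).map_lfp

/-- Time iteration preserves antitone functions, since the consumption they induce is increasing,
and so do pointwise suprema. Least-fixed-point induction needs nothing more. -/
lemma antitone_margValStar (hU : M.UtilityAssumption) : Antitone (margValStar hU) := by
  refine OrderHom.lfp_induction (timeIter hU) (p := Antitone)
    (fun g hg _ => antitone_margVal hU (monotone_con hg)) fun s hs a b hab => ?_
  rw [sSup_apply, sSup_apply]
  exact iSup_mono fun f => hs f.1 f.2 hab

/-! ### Bounds and continuity for the fixed point. -/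

namespace Assumptions

/-- Under iid shocks the `n`-period condition is `(β E R)^n < 1`. -/
lemma β_mul_ret_lt_one (hM : M.Assumptions) :
    (M.β : ℝ≥0∞) * ∫⁻ x, (M.ret x : ℝ≥0∞) ∂M.shockLaw < 1 := by
  obtain ⟨n, hn⟩ := hM.contraction
  rw [seqLaw, lintegral_infinitePi_prod_range M.shockLaw M.measurable_ret.coe_nnreal_ennreal,
    ← mul_pow] at hn
  by_contra! h
  exact absurd (one_le_pow₀ h) (not_le.2 hn)

lemma inc_finite (hM : M.Assumptions) : ∫⁻ x, (M.inc x : ℝ≥0∞) ∂M.shockLaw < ⊤ := by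
  refine lt_of_le_of_lt ?_ hM.income_bounded
  refine le_trans ?_ (le_iSup _ 0)
  rw [seqLaw, lintegral_infinitePi_eval_zero M.shockLaw M.measurable_inc.coe_nnreal_ennreal]

/-- `E u'(Y)` is finite while `u'(0) = ∞`. -/
lemma inc_pos_ae (hM : M.Assumptions) : ∀ᵐ x ∂M.shockLaw, 0 < M.inc x := by
  filter_upwards [ae_lt_top (hM.utility.measurable_marg.comp M.measurable_inc) hM.marg_finite.ne]
    with x hx
  rcases eq_zero_or_pos (M.inc x) with h | h
  · simp [h, marg_zero] at hx
  · exact h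

/-- A uniform bound for the marginal value of savings. -/
lemma exists_margValStar_le (hM : M.Assumptions) :
    ∃ K : ℝ≥0∞, K ≠ ⊤ ∧ ∀ s, margValStar hM.utility s ≤ K := by
  have hU := hM.utility
  set ρ := (M.β : ℝ≥0∞) * ∫⁻ x, (M.ret x : ℝ≥0∞) ∂M.shockLaw with hρ
  set L := (M.β : ℝ≥0∞) * ∫⁻ x, (M.ret x : ℝ≥0∞) * M.marg (M.inc x) ∂M.shockLaw with hL
  have hρ1 : ρ < 1 := hM.β_mul_ret_lt_one
  have hL' : L ≠ ⊤ := ENNReal.mul_ne_top ENNReal.coe_ne_top hM.ret_marg_finite.ne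
  have h0 : 1 - ρ ≠ 0 := (tsub_pos_of_lt hρ1).ne'
  refine ⟨L / (1 - ρ), ENNReal.div_ne_top hL' h0, ?_⟩
  set K := L / (1 - ρ) with hK
  have hfix : L + ρ * K = K := ENNReal.add_mul_div_one_sub hρ1 L
  -- A prefixed point suffices. For the constant `K`, marginal utility next period is at most `u'(Y)
  -- + K`, which gives the bound `L + ρ K = K`.
  refine OrderHom.lfp_le (timeIter hU) (a := fun _ => K) fun s => ?_
  change M.margVal (M.con fun _ => K) s ≤ K
  have hr := M.measurable_ret.coe_nnreal_ennreal
  calc M.margVal (M.con fun _ => K) s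
      ≤ M.β * ∫⁻ x, ((M.ret x : ℝ≥0∞) * M.marg (M.inc x) + (M.ret x : ℝ≥0∞) * K)
          ∂M.shockLaw := by
        unfold margVal
        gcongr with x
        rw [← mul_add]
        gcongr
        refine (marg_con_le hU antitone_const _).trans (max_le ?_ le_add_self)
        exact (hU.marg_antitone le_add_self).trans le_self_add
    _ = L + ρ * K := by
        rw [lintegral_add_right _ (hr.mul_const K), lintegral_mul_const _ hr, mul_add, ← mul_assoc]
    _ = K := hfix

/-- Dominated convergence with majorant `R u'(Y) + R K`, where `K` is the uniform bound on the fixed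
point. -/
lemma continuous_margValStar (hM : M.Assumptions) : Continuous (margValStar hM.utility) := by
  have hU := hM.utility
  have hanti := antitone_margValStar hU
  obtain ⟨K, hK, hle⟩ := hM.exists_margValStar_le
  have hr := M.measurable_ret.coe_nnreal_ennreal
  rw [← margVal_con_margValStar hU, continuous_iff_continuousAt]
  intro s
  refine ENNReal.Tendsto.const_mul ?_ (Or.inr ENNReal.coe_ne_top)
  have hcont := hU.continuous_marg.comp (continuous_con hU hanti)
  refine tendsto_lintegral_filter_of_dominated_convergence
    (fun x => (M.ret x : ℝ≥0∞) * M.marg (M.inc x) + (M.ret x : ℝ≥0∞) * K) ?_ ?_ ?_ ?_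
  · refine .of_forall fun t => hr.mul (hcont.measurable.comp ?_)
    exact (M.measurable_ret.mul_const t).add M.measurable_inc
  · refine .of_forall fun t => .of_forall fun x => ?_
    rw [← mul_add]
    gcongr
    refine (marg_con_le hU hanti _).trans (max_le ?_ ((hle 0).trans le_add_self))
    exact (hU.marg_antitone le_add_self).trans le_self_add
  · rw [lintegral_add_right _ (hr.mul_const K), lintegral_mul_const _ hr]
    exact ENNReal.add_ne_top.2 ⟨hM.ret_marg_finite.ne, ENNReal.mul_ne_top hM.ret_finite.ne hK⟩
  · refine .of_forall fun x => ?_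
    refine ENNReal.Tendsto.const_mul ?_ (Or.inr ENNReal.coe_ne_top)
    exact (hcont.comp ((continuous_const.mul continuous_id).add continuous_const)).tendsto s

/-- The share of wealth consumed is bounded below. -/
lemma exists_mul_le_con (hM : M.Assumptions) :
    ∃ α : ℝ≥0, 0 < α ∧ ((1 - α : ℝ≥0) : ℝ≥0∞) * ∫⁻ x, (M.ret x : ℝ≥0∞) ∂M.shockLaw < 1 ∧
      ∀ a, α * a ≤ M.con (margValStar hM.utility) a := by
  have hU := hM.utility
  obtain ⟨α, hα0, hα1, hα, n, hn⟩ := hM.consumption_rate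
  refine ⟨α, hα0, ?_, ?_⟩
  · rw [seqLaw, lintegral_infinitePi_prod_range M.shockLaw M.measurable_ret.coe_nnreal_ennreal,
      ← mul_pow] at hn
    by_contra! h
    exact absurd (one_le_pow₀ h) (not_le.2 hn)
  · have hα1' : 0 < 1 - α := tsub_pos_of_lt hα1
    -- With this marginal value, saving exactly `(1 - α) a` equates marginal cost and value, since
    -- then `a - s = α / (1 - α) * s`.
    set h : ℝ≥0 → ℝ≥0∞ := fun s => M.marg (α / (1 - α) * s) with hh
    have hcon (a : ℝ≥0) : α * a ≤ M.con h a := by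
      have hsav : M.sav h a ≤ (1 - α) * a := by
        refine csSup_le' fun s hs => ?_
        have h1 : α / (1 - α) * s ≤ a - s := hU.marg_strictAnti.le_iff_ge.1 hs.2
        have h2 := (le_tsub_iff_right hs.1).1 h1
        have h3 : α / (1 - α) * s + s = s / (1 - α) := by
          have : α + (1 - α) = 1 := add_tsub_cancel_of_le hα1.le
          field_simp
          rw [this, mul_one]
        rw [h3, div_le_iff₀ hα1'] at h2
        rwa [mul_comm]
      refine le_tsub_of_add_le_right ?_
      calc α * a + M.sav h a ≤ α * a + (1 - α) * a := by gcongr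
        _ = a := by rw [← add_mul, add_tsub_cancel_of_le hα1.le, one_mul]
    have hle : margValStar hU ≤ h := by
      refine OrderHom.lfp_le (timeIter hU) fun s => ?_
      change M.margVal (M.con h) s ≤ h s
      rcases eq_zero_or_pos s with rfl | hs
      · simp [hh, marg_zero]
      -- The assumption on `α` is taken at the wealth for which `R (1 - α)` times it equals `α R s`.
      -- This makes `h` a prefixed point.
      · refine le_trans ?_ (hα (α / (1 - α) * s) (by positivity))
        unfold margVal
        gcongr with x
        refine hU.marg_antitone (le_trans ?_ (hcon _))
        have : M.ret x * (1 - α) * (α / (1 - α) * s) = α * (M.ret x * s) := by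
          field_simp
        rw [this]
        gcongr
        exact le_self_add
    exact fun a => (hcon a).trans (con_le_con hle a)

end Assumptions

/-- A policy, as a function of wealth, that solves the Euler equation. -/
structure EulerPolicy (M : IncomeFluctuation Z E F) (c : ℝ≥0 → ℝ≥0) : Prop where
  continuous : Continuous c
  mono : Monotone c
  le : ∀ a, c a ≤ a
  sav_mono : Monotone fun a => a - c a
  rate : ∃ α : ℝ≥0, 0 < α ∧ ((1 - α : ℝ≥0) : ℝ≥0∞) * ∫⁻ x, (M.ret x : ℝ≥0∞) ∂M.shockLaw < 1 ∧
    ∀ a, α * a ≤ c a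
  margVal_ne_top : M.margVal c 0 ≠ ⊤
  marg_le : ∀ a, M.marg (c a) ≤ max (M.marg a) (M.margVal c 0)
  euler_le : ∀ a, M.margVal c (a - c a) ≤ M.marg (c a)
  euler_ge : ∀ a, 0 < a - c a → M.marg (c a) ≤ M.margVal c (a - c a)

theorem Assumptions.exists_eulerPolicy (hM : M.Assumptions) : ∃ c, M.EulerPolicy c := by
  have hU := hM.utility
  have hanti := antitone_margValStar hU
  obtain ⟨K, hK, hle⟩ := hM.exists_margValStar_le
  refine ⟨M.con (margValStar hU), continuous_con hU hanti, monotone_con hanti, con_le _, ?_,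
    hM.exists_mul_le_con, ?_, ?_, ?_, ?_⟩
  · simp only [sub_con]
    exact monotone_sav hU _
  · rw [margVal_con_margValStar]
    exact ne_top_of_le_ne_top hK (hle 0)
  · rw [margVal_con_margValStar]
    exact marg_con_le hU hanti
  · intro a
    rw [margVal_con_margValStar, sub_con]
    exact le_marg_con hU hM.continuous_margValStar a
  · intro a
    rw [margVal_con_margValStar, sub_con]
    exact marg_con_le_of_sav_pos hU hanti hM.continuous_margValStar

namespace EulerPolicy

variable {c : ℝ≥0 → ℝ≥0}

lemma pos (hc : M.EulerPolicy c) {a : ℝ≥0} (ha : 0 < a) : 0 < c a := by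
  obtain ⟨α, hα, -, hle⟩ := hc.rate
  exact (mul_pos hα ha).trans_le (hle a)

lemma marg_le_add (hc : M.EulerPolicy c) (a : ℝ≥0) :
    M.marg (c a) ≤ M.marg a + M.margVal c 0 :=
  (hc.marg_le a).trans (max_le le_self_add le_add_self)

lemma candidate (hU : M.UtilityAssumption) (hc : M.EulerPolicy c) :
    M.Candidate fun s => c s.1 where
  continuousOn := (hc.continuous.comp continuous_fst).continuousOn
  mono _ := hc.mono
  pos _ _ ha := hc.pos ha
  le a _ := hc.le a
  bounded := by
    refine ⟨(M.margVal c 0).toReal, fun a _ ha => ?_⟩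
    have hca := hc.pos ha
    have ha' : (0 : ℝ) < a := ha
    have hca' : (0 : ℝ) < c a := hca
    have h1 : deriv M.uReal a ≤ deriv M.uReal (c a) :=
      hU.deriv_strictAntiOn.antitoneOn (Set.mem_Ioi.2 hca') (Set.mem_Ioi.2 ha')
        (NNReal.coe_le_coe.2 (hc.le a))
    have h2 := hc.marg_le_add a
    rw [marg_of_pos hca, marg_of_pos ha, ENNReal.ofReal_le_iff_le_toReal
      (ENNReal.add_ne_top.2 ⟨ENNReal.ofReal_ne_top, hc.margVal_ne_top⟩),
      ENNReal.toReal_add ENNReal.ofReal_ne_top hc.margVal_ne_top,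
      ENNReal.toReal_ofReal (hU.deriv_pos _ ha').le] at h2
    rw [abs_of_nonneg (sub_nonneg.2 h1)]
    linarith

end EulerPolicy

end IncomeFluctuation

/-! ### Discounted expectations along random iterations -/

section Discounted

variable {X S : Type*} [MeasurableSpace S] {f : X → S → X}
  {ν : Measure S} [IsProbabilityMeasure ν] {β : ℝ≥0∞} {φ : X → ℝ≥0∞}

/-- The discounted expectation `E β^t φ(a_t)` along the path from `a_0 = s`. -/
noncomputable def discTerm (f : X → S → X) (ν : Measure S) [IsProbabilityMeasure ν] (β : ℝ≥0∞)
    (φ : X → ℝ≥0∞) (t : ℕ) (s : X) : ℝ≥0∞ :=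
  ∫⁻ w, β ^ t * φ (iterPath f s w t) ∂Measure.infinitePi (fun _ : ℕ => ν)

lemma discTerm_zero (s : X) : discTerm f ν β φ 0 s = φ s := by
  simp [discTerm, iterPath]

variable [MeasurableSpace X]

lemma discTerm_succ (hf : Measurable fun p : X × S => f p.1 p.2) (hφ : Measurable φ) (t : ℕ)
    (s : X) : discTerm f ν β φ (t + 1) s = β * ∫⁻ x, discTerm f ν β φ t (f s x) ∂ν := by
  have hm (t : ℕ) : Measurable fun p : X × (ℕ → S) => φ (iterPath f p.1 p.2 t) :=
    hφ.comp (measurable_iterPath hf t)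
  have hm' (t : ℕ) (a : X) : Measurable fun w : ℕ → S => φ (iterPath f a w t) :=
    (hm t).comp measurable_prodMk_left
  have hd (a : X) : discTerm f ν β φ t a =
      β ^ t * ∫⁻ w, φ (iterPath f a w t) ∂Measure.infinitePi (fun _ : ℕ => ν) :=
    lintegral_const_mul _ (hm' t a)
  have hI : Measurable fun a : X =>
      ∫⁻ w, φ (iterPath f a w t) ∂Measure.infinitePi (fun _ : ℕ => ν) :=
    (hm t).lintegral_prod_right'
  have hfs : Measurable fun x => ∫⁻ w, φ (iterPath f (f s x) w t)
      ∂Measure.infinitePi (fun _ : ℕ => ν) := hI.comp (hf.comp measurable_prodMk_left)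
  simp_rw [hd]
  rw [lintegral_const_mul _ hfs, discTerm, lintegral_const_mul _ (hm' (t + 1) s),
    lintegral_infinitePi_eq_seqCons ν (hm' (t + 1) s)]
  simp only [iterPath_succ', seqCons_zero, seqShift_seqCons]
  rw [pow_succ']
  ring

lemma measurable_discTerm (hf : Measurable fun p : X × S => f p.1 p.2) (hφ : Measurable φ) (t : ℕ) :
    Measurable (discTerm f ν β φ t) :=
  Measurable.lintegral_prod_right'
    (f := fun p : X × (ℕ → S) => β ^ t * φ (iterPath f p.1 p.2 t))
    ((hφ.comp (measurable_iterPath hf t)).const_mul _)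

lemma sum_discTerm_succ (hf : Measurable fun p : X × S => f p.1 p.2) (hφ : Measurable φ) (T : ℕ)
    (s : X) : ∑ t ∈ Finset.range (T + 1), discTerm f ν β φ t s =
      φ s + β * ∫⁻ x, ∑ t ∈ Finset.range T, discTerm f ν β φ t (f s x) ∂ν := by
  have hm (t : ℕ) : Measurable fun x => discTerm f ν β φ t (f s x) :=
    (measurable_discTerm hf hφ t).comp (hf.comp measurable_prodMk_left)
  rw [Finset.sum_range_succ', discTerm_zero, add_comm, lintegral_finsetSum _ fun t _ => hm t,
    Finset.mul_sum]
  simp_rw [discTerm_succ hf hφ]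

lemma lintegral_tsum_eq_tsum_discTerm (hf : Measurable fun p : X × S => f p.1 p.2)
    (hφ : Measurable φ) (s : X) :
    ∫⁻ w, ∑' t, β ^ t * φ (iterPath f s w t) ∂Measure.infinitePi (fun _ : ℕ => ν) =
      ∑' t, discTerm f ν β φ t s :=
  lintegral_tsum fun t => ((hφ.comp ((measurable_iterPath hf t).comp
    measurable_prodMk_left)).const_mul _).aemeasurable

/-- Supersolutions bound the expected discounted sum. -/
lemma tsum_discTerm_le (hf : Measurable fun p : X × S => f p.1 p.2) (hφ : Measurable φ)
    {Φ : X → ℝ≥0∞} (h : ∀ s, φ s + β * ∫⁻ x, Φ (f s x) ∂ν ≤ Φ s) (s : X) :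
    ∑' t, discTerm f ν β φ t s ≤ Φ s := by
  refine ENNReal.tsum_le_of_sum_range_le fun T => ?_
  induction T generalizing s with
  | zero => simp
  | succ T ih =>
    rw [sum_discTerm_succ hf hφ]
    refine le_trans ?_ (h s)
    gcongr with x
    exact ih _

lemma tsum_discTerm_ne_top_of_le {φ' : X → ℝ≥0∞} (hf : Measurable fun p : X × S => f p.1 p.2)
    (hφ' : Measurable φ') {C : ℝ≥0∞} (hC : C ≠ ⊤) (h : ∀ s, φ s ≤ C * φ' s) {s : X}
    (hfin : ∑' t, discTerm f ν β φ' t s ≠ ⊤) : ∑' t, discTerm f ν β φ t s ≠ ⊤ := by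
  refine ne_top_of_le_ne_top (ENNReal.mul_ne_top hC hfin) ?_
  rw [← ENNReal.tsum_mul_left]
  refine ENNReal.tsum_le_tsum fun t => ?_
  have hm : Measurable fun w : ℕ → S => β ^ t * φ' (iterPath f s w t) :=
    ((hφ'.comp (measurable_iterPath hf t)).comp measurable_prodMk_left).const_mul _
  simp only [discTerm]
  rw [← lintegral_const_mul C hm]
  refine lintegral_mono fun w => ?_
  rw [mul_left_comm]
  gcongr
  exact h _

end Discounted

namespace IncomeFluctuation

variable {m : ℕ} {Z : Set (EuclideanSpace ℝ (Fin m))} {E F : Type*}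
  [MeasurableSpace E] [MeasurableSpace F] {M : IncomeFluctuation Z E F}

/-! ### Utility -/

namespace UtilityAssumption

lemma coe_uReal (hU : M.UtilityAssumption) {c : ℝ≥0} (hc : 0 < c) :
    ((M.uReal c : ℝ) : EReal) = M.u c := by
  rw [uReal, Real.toNNReal_coe, EReal.coe_toReal (hU.ne_top c) (hU.ne_bot c hc)]

lemma uReal_strictMonoOn (hU : M.UtilityAssumption) : StrictMonoOn M.uReal (Set.Ioi 0) :=
  strictMonoOn_of_deriv_pos (convex_Ioi 0) hU.differentiable.continuousOn fun c hc =>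
    hU.deriv_pos c (by simpa using hc)

lemma monotone_u (hU : M.UtilityAssumption) : Monotone M.u := by
  intro a b hab
  rcases eq_zero_or_pos a with rfl | ha
  · exact hU.u_zero_le b
  · have hb := ha.trans_le hab
    rw [← hU.coe_uReal ha, ← hU.coe_uReal hb, EReal.coe_le_coe_iff]
    exact hU.uReal_strictMonoOn.monotoneOn (NNReal.coe_pos.2 ha) (NNReal.coe_pos.2 hb)
      (NNReal.coe_le_coe.2 hab)

lemma measurable_u (hU : M.UtilityAssumption) : Measurable M.u := hU.monotone_u.measurable

lemma uReal_lt_tangent (hU : M.UtilityAssumption) {c d : ℝ} (hc : 0 < c) (hd : 0 < d)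
    (hcd : d ≠ c) : M.uReal d < M.uReal c + deriv M.uReal c * (d - c) := by
  have hcont {a b : ℝ} (ha : 0 < a) : ContinuousOn M.uReal (Set.Icc a b) :=
    hU.differentiable.continuousOn.mono fun x hx => ha.trans_le hx.1
  have hdiff {a b : ℝ} (ha : 0 < a) : DifferentiableOn ℝ M.uReal (Set.Ioo a b) :=
    hU.differentiable.mono fun x hx => ha.trans hx.1
  rcases hcd.lt_or_gt with h | h
  · obtain ⟨ξ, hξ, he⟩ := exists_deriv_eq_slope M.uReal h (hcont hd) (hdiff hd)
    have h1 := hU.deriv_strictAntiOn (Set.mem_Ioi.2 (hd.trans hξ.1)) (Set.mem_Ioi.2 hc) hξ.2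
    rw [he, lt_div_iff₀ (sub_pos.2 h)] at h1
    linarith
  · obtain ⟨ξ, hξ, he⟩ := exists_deriv_eq_slope M.uReal h (hcont hc) (hdiff hc)
    have h1 := hU.deriv_strictAntiOn (Set.mem_Ioi.2 hc) (Set.mem_Ioi.2 (hc.trans hξ.1)) hξ.1
    rw [he, div_lt_iff₀ (sub_pos.2 h)] at h1
    linarith

lemma uReal_le_tangent (hU : M.UtilityAssumption) {c d : ℝ} (hc : 0 < c) (hd : 0 < d) :
    M.uReal d ≤ M.uReal c + deriv M.uReal c * (d - c) := by
  rcases eq_or_ne d c with rfl | h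
  · simp
  · exact (hU.uReal_lt_tangent hc hd h).le

/-- Treats zero consumption when `u(0)` is finite; `u` may jump at zero. The weak inequality follows
from the tangent at `b` evaluated at `ε / u'(b)`, and strictness from passing through `c / 2`. -/
lemma lt_tangent_at_zero (hU : M.UtilityAssumption) {r : ℝ} (hr : ∀ x : ℝ, 0 < x → r ≤ M.uReal x)
    {c : ℝ} (hc : 0 < c) : r < M.uReal c + deriv M.uReal c * (0 - c) := by
  have weak {b : ℝ} (hb : 0 < b) : r ≤ M.uReal b + deriv M.uReal b * (0 - b) := by
    refine le_of_forall_pos_le_add fun ε hε => ?_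
    have hp := hU.deriv_pos b hb
    have h1 := (hr _ (div_pos hε hp)).trans (hU.uReal_le_tangent hb (div_pos hε hp))
    rw [mul_sub, mul_div_cancel₀ _ hp.ne'] at h1
    linarith
  have h2 : 0 < c / 2 := half_pos hc
  have h3 := weak h2
  have h4 := hU.deriv_strictAntiOn (Set.mem_Ioi.2 h2) (Set.mem_Ioi.2 hc) (half_lt_self hc)
  have h5 := hU.uReal_le_tangent hc h2
  nlinarith

/-- Real inequalities are transferred to `[0, ∞]` by moving negative parts to the other side, with
the slack kept as a separate term. -/
lemma add_add_le_add_add_of_real {x y p q : ℝ} (hp : 0 ≤ p) (hq : 0 ≤ q) (h : y ≤ x + (q - p)) :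
    ENNReal.ofReal y + ENNReal.ofReal (-x) + ENNReal.ofReal p + ENNReal.ofReal (x + (q - p) - y) ≤
      ENNReal.ofReal x + ENNReal.ofReal (-y) + ENNReal.ofReal q := by
  have hmax (z : ℝ) : ENNReal.ofReal z = ENNReal.ofReal (max z 0) := by
    rcases le_total z 0 with h | h <;> simp [h]
  rw [hmax y, hmax (-x), hmax x, hmax (-y), ← ENNReal.ofReal_add (by positivity) (by positivity),
    ← ENNReal.ofReal_add (by positivity) (by positivity),
    ← ENNReal.ofReal_add (by positivity) (by linarith),
    ← ENNReal.ofReal_add (by positivity) (by positivity),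
    ← ENNReal.ofReal_add (by positivity) (by positivity)]
  apply ENNReal.ofReal_le_ofReal
  have h1 : max x 0 - max (-x) 0 = x := by
    rcases le_total x 0 with h | h <;> simp [h]
  have h2 : max y 0 - max (-y) 0 = y := by
    rcases le_total y 0 with h | h <;> simp [h]
  linarith

/-- Concavity of utility in terms of positive and negative parts. -/
lemma exists_concavity_gap (hU : M.UtilityAssumption) {c : ℝ≥0} (hc : 0 < c) (d : ℝ≥0) :
    ∃ δ : ℝ≥0∞, (d ≠ c → 0 < δ) ∧
      (M.u d).toENNReal + (-M.u c).toENNReal + M.marg c * c + δ ≤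
        (M.u c).toENNReal + (-M.u d).toENNReal + M.marg c * d := by
  have hc' : (0 : ℝ) < c := hc
  have hdc := (hU.deriv_pos c hc').le
  have hmul (e : ℝ≥0) : M.marg c * e = ENNReal.ofReal (deriv M.uReal c * e) := by
    rw [marg_of_pos hc, ENNReal.ofReal_mul hdc, ENNReal.ofReal_coe_nnreal]
  have key (y : ℝ) (hy : M.u d = (y : EReal))
      (hle : y ≤ M.uReal c + deriv M.uReal c * (d - c))
      (hlt : d ≠ c → y < M.uReal c + deriv M.uReal c * (d - c)) :
      ∃ δ : ℝ≥0∞, (d ≠ c → 0 < δ) ∧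
      (M.u d).toENNReal + (-M.u c).toENNReal + M.marg c * c + δ ≤
        (M.u c).toENNReal + (-M.u d).toENNReal + M.marg c * d := by
    rw [mul_sub] at hle hlt
    refine ⟨ENNReal.ofReal (M.uReal c + (deriv M.uReal c * d - deriv M.uReal c * c) - y),
      fun h => ENNReal.ofReal_pos.2 (by linarith [hlt h]), ?_⟩
    rw [← hU.coe_uReal hc, hy, hmul, hmul, ← EReal.coe_neg, ← EReal.coe_neg]
    simp only [EReal.toENNReal_of_ne_top (EReal.coe_ne_top _), EReal.toReal_coe]
    exact add_add_le_add_add_of_real (by positivity) (by positivity) hle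
  rcases eq_zero_or_pos d with rfl | hd
  · rcases eq_or_ne (M.u 0) ⊥ with hb | hb
    -- If `u(0) = -∞`, the right side is infinite and any positive gap works.
    · exact ⟨1, fun _ => one_pos, by simp [hb]⟩
    · have hcoe : (((M.u 0).toReal : ℝ) : EReal) = M.u 0 := EReal.coe_toReal (hU.ne_top 0) hb
      have hlt := hU.lt_tangent_at_zero (r := (M.u 0).toReal) (fun x hx => by
        have h1 := hU.u_zero_le ⟨x, hx.le⟩
        rw [← hcoe, ← hU.coe_uReal (c := ⟨x, hx.le⟩) hx, EReal.coe_le_coe_iff] at h1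
        exact h1) hc'
      exact key _ hcoe.symm (by simpa using hlt.le) fun _ => by simpa using hlt
  · have hd' : (0 : ℝ) < d := hd
    exact key _ (hU.coe_uReal hd).symm (hU.uReal_le_tangent hc' hd') fun h =>
      hU.uReal_lt_tangent hc' hd' fun h' => h (NNReal.coe_injective h')

lemma toENNReal_u_le (hU : M.UtilityAssumption) (c : ℝ≥0) :
    (M.u c).toENNReal ≤ ENNReal.ofReal |M.uReal 1| + M.marg 1 * c := by
  have hpos {c : ℝ≥0} (hc : 0 < c) :
      (M.u c).toENNReal ≤ ENNReal.ofReal |M.uReal 1| + M.marg 1 * c := by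
    have h1 := hU.uReal_le_tangent one_pos (NNReal.coe_pos.2 hc)
    have hp := (hU.deriv_pos 1 one_pos).le
    rw [← hU.coe_uReal hc, EReal.toENNReal_of_ne_top (EReal.coe_ne_top _), EReal.toReal_coe,
      marg_of_pos one_pos, ← ENNReal.ofReal_coe_nnreal, ← ENNReal.ofReal_mul (by simpa using hp),
      ← ENNReal.ofReal_add (abs_nonneg _) (by simp only [NNReal.coe_one]; positivity)]
    apply ENNReal.ofReal_le_ofReal
    simp only [NNReal.coe_one]
    linarith [le_abs_self (M.uReal 1)]
  rcases eq_zero_or_pos c with rfl | hc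
  · have h1 : (M.u 0).toENNReal ≤ ENNReal.ofReal |M.uReal 1| := by
      refine (EReal.toENNReal_le_toENNReal (hU.u_zero_le 1)).trans ?_
      rw [← hU.coe_uReal one_pos, EReal.toENNReal_of_ne_top (EReal.coe_ne_top _), EReal.toReal_coe]
      exact ENNReal.ofReal_le_ofReal (le_abs_self _)
    simpa using h1
  · exact hpos hc

/-- The tangent at `c`, evaluated at `1`, controls losses by marginal utility, whose discounted
expectation along a path can be bounded. -/
lemma toENNReal_neg_u_le (hU : M.UtilityAssumption) (c : ℝ≥0) :
    (-M.u c).toENNReal ≤ ENNReal.ofReal |M.uReal 1| + M.marg c := by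
  rcases eq_zero_or_pos c with rfl | hc
  · simp [marg_zero]
  · have hc' : (0 : ℝ) < c := hc
    have h1 := hU.uReal_le_tangent hc' one_pos
    have hp := hU.deriv_pos c hc'
    rw [← hU.coe_uReal hc, ← EReal.coe_neg, EReal.toENNReal_of_ne_top (EReal.coe_ne_top _),
      EReal.toReal_coe, marg_of_pos hc, ← ENNReal.ofReal_add (abs_nonneg _) hp.le]
    apply ENNReal.ofReal_le_ofReal
    nlinarith [neg_abs_le (M.uReal 1)]

lemma marg_mul_self_le (hU : M.UtilityAssumption) (a : ℝ≥0) :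
    M.marg a * a ≤ M.marg 1 * a + M.marg a := by
  rcases le_total a 1 with h | h
  · refine le_trans ?_ le_add_self
    calc M.marg a * a ≤ M.marg a * 1 := by gcongr; exact_mod_cast h
      _ = M.marg a := mul_one _
  · refine le_trans ?_ le_self_add
    gcongr
    exact hU.marg_antitone h

end UtilityAssumption

end IncomeFluctuation

/-- Returns from the additive form to differences in `[-∞, ∞]`. Only `q'`, the losses of the
competing policy, may be infinite; the left side is then `-∞`. -/
lemma ENNReal.coe_sub_le_coe_sub {p q p' q' δ : ℝ≥0∞} (hp : p ≠ ⊤) (hq : q ≠ ⊤) (hp' : p' ≠ ⊤)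
    (h : p + q + δ ≤ p' + q') :
    (p : EReal) - q' ≤ p' - q ∧ (0 < δ → (p : EReal) - q' < p' - q) := by
  lift p to ℝ≥0 using hp
  lift q to ℝ≥0 using hq
  lift p' to ℝ≥0 using hp'
  have hco (x : ℝ≥0) : ((x : ℝ≥0∞) : EReal) = ((x : ℝ) : EReal) := rfl
  rcases eq_or_ne q' ⊤ with rfl | hq'
  · rw [hco p, hco p', hco q, EReal.coe_ennreal_top, EReal.sub_top, ← EReal.coe_sub]
    exact ⟨bot_le, fun _ => EReal.bot_lt_coe _⟩
  · lift q' to ℝ≥0 using hq'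
    have hδ : δ ≠ ⊤ := by
      rintro rfl
      simp only [add_top, top_le_iff] at h
      exact ENNReal.coe_ne_top (r := p' + q') (by exact_mod_cast h)
    lift δ to ℝ≥0 using hδ
    have h' : (p : ℝ) + q + δ ≤ p' + q' := by exact_mod_cast h
    rw [hco p, hco p', hco q, hco q', ← EReal.coe_sub, ← EReal.coe_sub, EReal.coe_le_coe_iff,
      EReal.coe_lt_coe_iff]
    refine ⟨by linarith [δ.coe_nonneg], fun hpos => ?_⟩
    have : (0 : ℝ) < δ := by exact_mod_cast hpos
    linarith

namespace IncomeFluctuation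

variable {m : ℕ} {Z : Set (EuclideanSpace ℝ (Fin m))} {E F : Type*}
  [MeasurableSpace E] [MeasurableSpace F] {M : IncomeFluctuation Z E F}

/-! ### Optimality of solutions to the Euler equation -/

/-- Next period's state. -/
def nextState (M : IncomeFluctuation Z E F) (d : ℝ≥0 × Z → ℝ≥0) (s : ℝ≥0 × Z) (x : Z × E × F) :
    ℝ≥0 × Z :=
  (M.ret x * (s.1 - d s) + M.inc x, x.1)

lemma statePath_eq_iterPath (d : ℝ≥0 × Z → ℝ≥0) (s : ℝ≥0 × Z) (w : ℕ → Z × E × F) (t : ℕ) :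
    M.statePath d s w t = iterPath (M.nextState d) s w t := by
  induction t with
  | zero => rfl
  | succ t ih => rw [statePath, ih]; rfl

lemma measurable_nextState {d : ℝ≥0 × Z → ℝ≥0} (hd : Measurable d) :
    Measurable fun p : (ℝ≥0 × Z) × (Z × E × F) => M.nextState d p.1 p.2 :=
  (((M.measurable_ret.comp measurable_snd).mul
    ((measurable_fst.comp measurable_fst).sub (hd.comp measurable_fst))).add
      (M.measurable_inc.comp measurable_snd)).prodMk (measurable_fst.comp measurable_snd)

/-- Positive part of the flow utility of a policy. -/
noncomputable def posPart (M : IncomeFluctuation Z E F)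
    (d : ℝ≥0 × Z → ℝ≥0) (s : ℝ≥0 × Z) : ℝ≥0∞ := (M.u (d s)).toENNReal

/-- Negative part of the flow utility of a policy. -/
noncomputable def negPart (M : IncomeFluctuation Z E F)
    (d : ℝ≥0 × Z → ℝ≥0) (s : ℝ≥0 × Z) : ℝ≥0∞ := (-M.u (d s)).toENNReal

lemma UtilityAssumption.measurable_posPart (hU : M.UtilityAssumption)
    {d : ℝ≥0 × Z → ℝ≥0} (hd : Measurable d) : Measurable (M.posPart d) :=
  (hU.measurable_u.comp hd).ereal_toENNReal

lemma UtilityAssumption.measurable_negPart (hU : M.UtilityAssumption)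
    {d : ℝ≥0 × Z → ℝ≥0} (hd : Measurable d) : Measurable (M.negPart d) :=
  (hU.measurable_u.comp hd).neg.ereal_toENNReal

/-- The expected discounted sum of `φ` along the state path generated by `d`. -/
noncomputable def discVal (M : IncomeFluctuation Z E F) (d : ℝ≥0 × Z → ℝ≥0)
    (φ : ℝ≥0 × Z → ℝ≥0∞) (s : ℝ≥0 × Z) : ℝ≥0∞ :=
  ∑' t, discTerm (M.nextState d) M.shockLaw M.β φ t s

lemma lifetimeValue_eq (hU : M.UtilityAssumption) {d : ℝ≥0 × Z → ℝ≥0} (hd : Measurable d)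
    (s : ℝ≥0 × Z) :
    M.lifetimeValue d s = (M.discVal d (M.posPart d) s : EReal) -
      (M.discVal d (M.negPart d) s : EReal) := by
  rw [discVal, discVal, ← lintegral_tsum_eq_tsum_discTerm (measurable_nextState hd)
    (hU.measurable_posPart hd), ← lintegral_tsum_eq_tsum_discTerm (measurable_nextState hd)
    (hU.measurable_negPart hd)]
  simp only [lifetimeValue, statePath_eq_iterPath, seqLaw, posPart, negPart]

/-- Constant multiples of `1 + a + u'(a)` dominate the utility gains of every feasible policy, and
the utility losses and valued wealth of an Euler policy. -/
lemma measurable_growth (hU : M.UtilityAssumption) :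
    Measurable fun s : ℝ≥0 × Z => 1 + (s.1 : ℝ≥0∞) + M.marg s.1 :=
  (measurable_const.add measurable_fst.coe_nnreal_ennreal).add
    (hU.measurable_marg.comp measurable_fst)

lemma Assumptions.discVal_growth_ne_top (hM : M.Assumptions) {d : ℝ≥0 × Z → ℝ≥0}
    (hd : Measurable d) {s : ℝ≥0 × Z} (hs : 0 < s.1) :
    M.discVal d (fun s => 1 + (s.1 : ℝ≥0∞) + M.marg s.1) s ≠ ⊤ := by
  have hU := hM.utility
  set ER := ∫⁻ x, (M.ret x : ℝ≥0∞) ∂M.shockLaw with hER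
  set EY := ∫⁻ x, (M.inc x : ℝ≥0∞) ∂M.shockLaw with hEY
  set EU := ∫⁻ x, M.marg (M.inc x) ∂M.shockLaw with hEU
  have hρ : M.β * ER < 1 := hM.β_mul_ret_lt_one
  have hβ : (M.β : ℝ≥0∞) < 1 := by exact_mod_cast M.β_lt_one
  -- In the supersolution `κ + q a + u'(a)`, `q` absorbs the growth of wealth and `κ` absorbs the
  -- constants. The term `u'` needs no coefficient because next period's wealth is at least `Y`.
  set q := 1 / (1 - M.β * ER) with hq
  have hq' : q ≠ ⊤ := ENNReal.div_ne_top ENNReal.one_ne_top (tsub_pos_of_lt hρ).ne'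
  have hqe : 1 + M.β * ER * q = q := ENNReal.add_mul_div_one_sub hρ 1
  set L := 1 + M.β * (q * EY + EU) with hL
  have hL' : L ≠ ⊤ := ENNReal.add_ne_top.2 ⟨ENNReal.one_ne_top, ENNReal.mul_ne_top
    ENNReal.coe_ne_top (ENNReal.add_ne_top.2
      ⟨ENNReal.mul_ne_top hq' hM.inc_finite.ne, hM.marg_finite.ne⟩)⟩
  set κ := L / (1 - M.β) with hκ
  have hκ' : κ ≠ ⊤ := ENNReal.div_ne_top hL' (tsub_pos_of_lt hβ).ne'
  have hκe : L + M.β * κ = κ := ENNReal.add_mul_div_one_sub hβ L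
  have hr := M.measurable_ret.coe_nnreal_ennreal
  have hy := M.measurable_inc.coe_nnreal_ennreal
  have hm : Measurable fun x => M.marg (M.inc x) := hU.measurable_marg.comp M.measurable_inc
  have hsuper := tsum_discTerm_le (measurable_nextState (M := M) hd) (measurable_growth hU)
    (ν := M.shockLaw) (β := M.β) (Φ := fun s => κ + q * s.1 + M.marg s.1) (fun s => ?_) s
  · refine ne_top_of_le_ne_top ?_ hsuper
    exact ENNReal.add_ne_top.2 ⟨ENNReal.add_ne_top.2
      ⟨hκ', ENNReal.mul_ne_top hq' ENNReal.coe_ne_top⟩, marg_ne_top hs⟩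
  · have hint : ∫⁻ x, (κ + q * (M.nextState d s x).1 + M.marg (M.nextState d s x).1)
        ∂M.shockLaw ≤ κ + q * (ER * s.1 + EY) + EU := by
      calc _ ≤ ∫⁻ x, (κ + q * ((M.ret x : ℝ≥0∞) * s.1 + M.inc x) + M.marg (M.inc x))
            ∂M.shockLaw := by
            refine lintegral_mono fun x => ?_
            simp only [nextState]
            gcongr
            · push_cast
              gcongr
              exact tsub_le_self
            · exact hU.marg_antitone le_add_self
        _ = _ := by
            have hry : Measurable fun x => (M.ret x : ℝ≥0∞) * s.1 + M.inc x :=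
              (hr.mul_const _).add hy
            rw [lintegral_add_right _ hm, lintegral_add_left measurable_const,
              lintegral_const_mul _ hry, lintegral_add_right _ hy,
              lintegral_mul_const _ hr, lintegral_const, measure_univ, mul_one]
    calc _ ≤ 1 + (s.1 : ℝ≥0∞) + M.marg s.1 + M.β * (κ + q * (ER * s.1 + EY) + EU) := by
          gcongr
      _ = (L + M.β * κ) + (1 + M.β * ER * q) * s.1 + M.marg s.1 := by
          rw [hL]; ring
      _ = _ := by rw [hκe, hqe]

namespace EulerPolicy

variable {c : ℝ≥0 → ℝ≥0}

lemma margVal_le_zero (hU : M.UtilityAssumption) (hc : M.EulerPolicy c) (s : ℝ≥0) :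
    M.margVal c s ≤ M.margVal c 0 := antitone_margVal hU hc.mono zero_le

lemma margVal_ne_top' (hU : M.UtilityAssumption) (hc : M.EulerPolicy c) (s : ℝ≥0) :
    M.margVal c s ≠ ⊤ := ne_top_of_le_ne_top hc.margVal_ne_top (hc.margVal_le_zero hU s)

/-- Finiteness allows the marginal value of labor income, common to both policies, to be cancelled
in `comparison_step`. -/
lemma lintegral_marg_mul_inc_ne_top (hM : M.Assumptions) (hc : M.EulerPolicy c) (s : ℝ≥0) :
    ∫⁻ x, M.marg (c (M.ret x * s + M.inc x)) * M.inc x ∂M.shockLaw ≠ ⊤ := by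
  have hU := hM.utility
  have hy := M.measurable_inc.coe_nnreal_ennreal
  have hm : Measurable fun x => M.marg (M.inc x) := hU.measurable_marg.comp M.measurable_inc
  refine ne_top_of_le_ne_top (b := ∫⁻ x, (M.marg 1 * M.inc x + M.marg (M.inc x) +
    M.margVal c 0 * M.inc x) ∂M.shockLaw) ?_ (lintegral_mono fun x => ?_)
  · rw [lintegral_add_right _ (hy.const_mul _), lintegral_add_right _ hm,
      lintegral_const_mul _ hy, lintegral_const_mul _ hy]
    exact ENNReal.add_ne_top.2 ⟨ENNReal.add_ne_top.2 ⟨ENNReal.mul_ne_top (marg_ne_top one_pos)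
      hM.inc_finite.ne, hM.marg_finite.ne⟩, ENNReal.mul_ne_top hc.margVal_ne_top hM.inc_finite.ne⟩
  · calc _ ≤ (M.marg (M.inc x) + M.margVal c 0) * M.inc x := by
          gcongr
          refine (hc.marg_le_add _).trans ?_
          gcongr
          exact hU.marg_antitone le_add_self
      _ ≤ _ := by
          rw [add_mul]
          gcongr
          exact hU.marg_mul_self_le _

/-- One step of the comparison between an Euler policy `c` and a feasible policy `d`. -/
lemma comparison_step (hM : M.Assumptions) (hc : M.EulerPolicy c) {d : ℝ≥0 × Z → ℝ≥0}
    (hd : Feasible d) {Dp Cm Cp Dm W : ℝ≥0 × Z → ℝ≥0∞} (hDp : Measurable Dp)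
    (hCm : Measurable Cm) (hCp : Measurable Cp) (hDm : Measurable Dm) (hW : Measurable W)
    (ih : ∀ s s' : ℝ≥0 × Z, 0 < s.1 → Dp s' + Cm s + M.marg (c s.1) * s.1 ≤
      Cp s + Dm s' + W s + M.marg (c s.1) * s'.1)
    {s s' : ℝ≥0 × Z} {dp cm cp dm δ : ℝ≥0∞}
    (hu : dp + cm + M.marg (c s.1) * c s.1 + δ ≤ cp + dm + M.marg (c s.1) * d s') :
    (dp + M.β * ∫⁻ x, Dp (M.nextState d s' x) ∂M.shockLaw) +
      (cm + M.β * ∫⁻ x, Cm (M.nextState (fun s => c s.1) s x) ∂M.shockLaw) +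
        M.marg (c s.1) * s.1 + δ ≤
    (cp + M.β * ∫⁻ x, Cp (M.nextState (fun s => c s.1) s x) ∂M.shockLaw) +
      (dm + M.β * ∫⁻ x, Dm (M.nextState d s' x) ∂M.shockLaw) +
        M.β * ∫⁻ x, W (M.nextState (fun s => c s.1) s x) ∂M.shockLaw +
          M.marg (c s.1) * s'.1 := by
  have hU := hM.utility
  set f := M.nextState (fun s => c s.1) with hf
  set f' := M.nextState d with hf'
  set σ := s.1 - c s.1 with hσ
  set σ' := s'.1 - d s' with hσ'
  set v := M.marg (c s.1) with hv
  set G := M.margVal c σ with hG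
  have hfm : Measurable (f s) :=
    (measurable_nextState (M := M) (hc.continuous.measurable.comp measurable_fst)).comp
      measurable_prodMk_left
  have hfm' : Measurable (f' s') :=
    (measurable_nextState (M := M) hd.measurable).comp measurable_prodMk_left
  have hr := M.measurable_ret.coe_nnreal_ennreal
  have hy := M.measurable_inc.coe_nnreal_ennreal
  have hvm : Measurable fun x => M.marg (c (f s x).1) :=
    hU.measurable_marg.comp (hc.continuous.measurable.comp (measurable_fst.comp hfm))
  set y := (M.β : ℝ≥0∞) * ∫⁻ x, M.marg (c (f s x).1) * M.inc x ∂M.shockLaw with hydef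
  have hyfin : y ≠ ⊤ := ENNReal.mul_ne_top ENNReal.coe_ne_top
    (hc.lintegral_marg_mul_inc_ne_top hM σ)
  have hGfin : G ≠ ⊤ := hc.margVal_ne_top' hU σ
  -- Next period's wealth, valued at marginal utility along the path of `c`, is affine in savings
  -- `τ`, with slope the Euler term `G`.
  have hlin (τ : ℝ≥0) : M.β * ∫⁻ x, M.marg (c (f s x).1) * ((M.ret x : ℝ≥0∞) * τ + M.inc x)
      ∂M.shockLaw = G * τ + y := by
    have h1 (x : Z × E × F) : M.marg (c (f s x).1) * ((M.ret x : ℝ≥0∞) * τ + M.inc x) =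
        (M.ret x : ℝ≥0∞) * M.marg (c (f s x).1) * τ + M.marg (c (f s x).1) * M.inc x := by ring
    have h2 : Measurable fun x => M.marg (c (f s x).1) * (M.inc x : ℝ≥0∞) := hvm.mul hy
    have h3 : Measurable fun x => (M.ret x : ℝ≥0∞) * M.marg (c (f s x).1) := hr.mul hvm
    simp_rw [h1]
    rw [lintegral_add_right _ h2, lintegral_mul_const _ h3, mul_add,
      ← mul_assoc]
    rfl
  have hint : M.β * ∫⁻ x, Dp (f' s' x) ∂M.shockLaw + M.β * ∫⁻ x, Cm (f s x) ∂M.shockLaw +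
      (G * σ + y) ≤ M.β * ∫⁻ x, Cp (f s x) ∂M.shockLaw + M.β * ∫⁻ x, Dm (f' s' x) ∂M.shockLaw +
        M.β * ∫⁻ x, W (f s x) ∂M.shockLaw + (G * σ' + y) := by
    rw [← hlin σ, ← hlin σ']
    simp only [← mul_add]
    have e1 : Measurable fun x => Dp (f' s' x) := hDp.comp hfm'
    have e2 : Measurable fun x => Cm (f s x) := hCm.comp hfm
    have e3 : Measurable fun x => Cp (f s x) := hCp.comp hfm
    have e4 : Measurable fun x => Dm (f' s' x) := hDm.comp hfm'
    have e5 : Measurable fun x => W (f s x) := hW.comp hfm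
    have e12 : Measurable fun x => Dp (f' s' x) + Cm (f s x) := e1.add e2
    have e34 : Measurable fun x => Cp (f s x) + Dm (f' s' x) := e3.add e4
    have e345 : Measurable fun x => Cp (f s x) + Dm (f' s' x) + W (f s x) := e34.add e5
    rw [← lintegral_add_left e1, ← lintegral_add_left e12, ← lintegral_add_left e3,
      ← lintegral_add_left e34, ← lintegral_add_left e345]
    gcongr 1
    refine lintegral_mono_ae ?_
    -- The induction hypothesis requires positive wealth, which positive income supplies.
    filter_upwards [hM.inc_pos_ae] with x hx
    have h1 := ih (f s x) (f' s' x) (hx.trans_le le_add_self)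
    have h2 : ((f s x).1 : ℝ≥0∞) = (M.ret x : ℝ≥0∞) * σ + M.inc x := by
      simp only [hf, nextState]; push_cast; rfl
    have h3 : ((f' s' x).1 : ℝ≥0∞) = (M.ret x : ℝ≥0∞) * σ' + M.inc x := by
      simp only [hf', nextState]; push_cast; rfl
    rwa [h2, h3] at h1
  -- This is `(v - G)(σ' - σ) ≥ 0`: either `v = G`, or savings `σ` vanish and `v ≥ G`.
  have heuler : v * σ + G * σ' ≤ G * σ + v * σ' := by
    have hle : G ≤ v := hc.euler_le s.1
    rcases eq_zero_or_pos σ with h0 | h0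
    · rw [h0]
      simp only [ENNReal.coe_zero, mul_zero, zero_add]
      gcongr
    · have : v = G := le_antisymm (hc.euler_ge s.1 h0) hle
      rw [this]
  have hsa : (s.1 : ℝ≥0∞) = c s.1 + σ := by
    rw [← ENNReal.coe_add, hσ, add_tsub_cancel_of_le (hc.le s.1)]
  have hsa' : (s'.1 : ℝ≥0∞) = d s' + σ' := by
    rw [← ENNReal.coe_add, hσ', add_tsub_cancel_of_le (hd.le s'.1 s'.2)]
  have hfin : y + G * σ + G * σ' ≠ ⊤ := ENNReal.add_ne_top.2 ⟨ENNReal.add_ne_top.2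
    ⟨hyfin, ENNReal.mul_ne_top hGfin ENNReal.coe_ne_top⟩,
    ENNReal.mul_ne_top hGfin ENNReal.coe_ne_top⟩
  refine (ENNReal.add_le_add_iff_right hfin).1 ?_
  have htot := add_le_add (add_le_add hint hu) heuler
  rw [hsa, hsa']
  refine le_trans (le_of_eq ?_) (htot.trans (le_of_eq ?_)) <;> ring

/-- Wealth valued at the marginal utility of consumption. -/
noncomputable def wealthVal (M : IncomeFluctuation Z E F) (c : ℝ≥0 → ℝ≥0) (s : ℝ≥0 × Z) : ℝ≥0∞ :=
  M.marg (c s.1) * s.1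

lemma measurable_wealthVal (hU : M.UtilityAssumption) (hc : M.EulerPolicy c) :
    Measurable (wealthVal M c) :=
  (hU.measurable_marg.comp (hc.continuous.measurable.comp measurable_fst)).mul
    measurable_fst.coe_nnreal_ennreal

/-- A supporting-line inequality for `T`-period values, with slope `u'(c)` in initial wealth. Two
initial states are needed because the wealth paths of `c` and `d` separate even if they start
together. The remainder is terminal wealth valued at marginal utility. -/
lemma comparison (hM : M.Assumptions) (hc : M.EulerPolicy c) {d : ℝ≥0 × Z → ℝ≥0}
    (hd : Feasible d) (T : ℕ) (s s' : ℝ≥0 × Z) (hs : 0 < s.1) :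
    ∑ t ∈ Finset.range T, discTerm (M.nextState d) M.shockLaw M.β (M.posPart d) t s' +
      ∑ t ∈ Finset.range T, discTerm (M.nextState fun s => c s.1) M.shockLaw M.β
        (M.negPart fun s => c s.1) t s + M.marg (c s.1) * s.1 ≤
    ∑ t ∈ Finset.range T, discTerm (M.nextState fun s => c s.1) M.shockLaw M.β
        (M.posPart fun s => c s.1) t s +
      ∑ t ∈ Finset.range T, discTerm (M.nextState d) M.shockLaw M.β (M.negPart d) t s' +
        discTerm (M.nextState fun s => c s.1) M.shockLaw M.β (wealthVal M c) T s +
          M.marg (c s.1) * s'.1 := by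
  have hU := hM.utility
  have hcm : Measurable fun s : ℝ≥0 × Z => c s.1 := hc.continuous.measurable.comp measurable_fst
  have hf := measurable_nextState (M := M) hcm
  have hf' := measurable_nextState (M := M) hd.measurable
  have hW := measurable_wealthVal hU hc
  induction T generalizing s s' with
  | zero =>
    rw [discTerm_zero]
    simp only [Finset.range_zero, Finset.sum_empty, zero_add]
    exact le_self_add
  | succ T ih =>
    obtain ⟨δ, -, hδ⟩ := hU.exists_concavity_gap (hc.pos hs) (d s')
    rw [sum_discTerm_succ hf' (hU.measurable_posPart hd.measurable),
      sum_discTerm_succ hf' (hU.measurable_negPart hd.measurable),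
      sum_discTerm_succ hf (hU.measurable_posPart hcm),
      sum_discTerm_succ hf (hU.measurable_negPart hcm), discTerm_succ hf hW]
    refine le_trans le_self_add (comparison_step hM hc hd ?_ ?_ ?_ ?_ ?_ ih hδ)
    · exact Finset.measurable_fun_sum _ fun t _ =>
        measurable_discTerm hf' (hU.measurable_posPart hd.measurable) t
    · exact Finset.measurable_fun_sum _ fun t _ =>
        measurable_discTerm hf (hU.measurable_negPart hcm) t
    · exact Finset.measurable_fun_sum _ fun t _ =>
        measurable_discTerm hf (hU.measurable_posPart hcm) t
    · exact Finset.measurable_fun_sum _ fun t _ =>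
        measurable_discTerm hf' (hU.measurable_negPart hd.measurable) t
    · exact measurable_discTerm hf hW T

lemma discVal_posPart_ne_top (hM : M.Assumptions) {d : ℝ≥0 × Z → ℝ≥0} (hd : Feasible d)
    {s : ℝ≥0 × Z} (hs : 0 < s.1) : M.discVal d (M.posPart d) s ≠ ⊤ := by
  have hU := hM.utility
  refine tsum_discTerm_ne_top_of_le (measurable_nextState hd.measurable) (measurable_growth hU)
    (C := ENNReal.ofReal |M.uReal 1| + M.marg 1) (ENNReal.add_ne_top.2
      ⟨ENNReal.ofReal_ne_top, marg_ne_top one_pos⟩) (fun s => ?_)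
    (hM.discVal_growth_ne_top hd.measurable hs)
  calc M.posPart d s ≤ ENNReal.ofReal |M.uReal 1| + M.marg 1 * d s := hU.toENNReal_u_le _
    _ ≤ ENNReal.ofReal |M.uReal 1| * 1 + M.marg 1 * s.1 := by
        rw [mul_one]
        gcongr
        exact hd.le s.1 s.2
    _ ≤ ENNReal.ofReal |M.uReal 1| * (1 + s.1 + M.marg s.1) +
          M.marg 1 * (1 + s.1 + M.marg s.1) := by
        gcongr
        · rw [add_assoc]; exact le_self_add
        · exact le_trans le_add_self le_self_add
    _ = _ := by ring

lemma feasible (hc : M.EulerPolicy c) : Feasible fun s : ℝ≥0 × Z => c s.1 :=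
  ⟨hc.continuous.measurable.comp measurable_fst, fun a _ => hc.le a⟩

lemma discVal_negPart_ne_top (hM : M.Assumptions) (hc : M.EulerPolicy c)
    {s : ℝ≥0 × Z} (hs : 0 < s.1) :
    M.discVal (fun s => c s.1) (M.negPart fun s => c s.1) s ≠ ⊤ := by
  have hU := hM.utility
  refine tsum_discTerm_ne_top_of_le (measurable_nextState hc.feasible.measurable)
    (measurable_growth hU) (C := ENNReal.ofReal |M.uReal 1| + M.margVal c 0 + 1)
    (ENNReal.add_ne_top.2 ⟨ENNReal.add_ne_top.2
      ⟨ENNReal.ofReal_ne_top, hc.margVal_ne_top⟩, ENNReal.one_ne_top⟩) (fun s => ?_)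
    (hM.discVal_growth_ne_top hc.feasible.measurable hs)
  calc M.negPart (fun s => c s.1) s ≤ ENNReal.ofReal |M.uReal 1| + M.marg (c s.1) :=
        hU.toENNReal_neg_u_le _
    _ ≤ ENNReal.ofReal |M.uReal 1| + (M.marg s.1 + M.margVal c 0) := by
        gcongr
        exact hc.marg_le_add _
    _ = (ENNReal.ofReal |M.uReal 1| + M.margVal c 0) * 1 + 1 * M.marg s.1 := by ring
    _ ≤ (ENNReal.ofReal |M.uReal 1| + M.margVal c 0) * (1 + s.1 + M.marg s.1) +
          1 * (1 + s.1 + M.marg s.1) := by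
        gcongr
        · rw [add_assoc]; exact le_self_add
        · exact le_add_self
    _ = _ := by ring

lemma discVal_wealthVal_ne_top (hM : M.Assumptions) (hc : M.EulerPolicy c)
    {s : ℝ≥0 × Z} (hs : 0 < s.1) :
    M.discVal (fun s => c s.1) (wealthVal M c) s ≠ ⊤ := by
  have hU := hM.utility
  refine tsum_discTerm_ne_top_of_le (measurable_nextState hc.feasible.measurable)
    (measurable_growth hU) (C := M.marg 1 + M.margVal c 0 + 1)
    (ENNReal.add_ne_top.2 ⟨ENNReal.add_ne_top.2
      ⟨marg_ne_top one_pos, hc.margVal_ne_top⟩, ENNReal.one_ne_top⟩) (fun s => ?_)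
    (hM.discVal_growth_ne_top hc.feasible.measurable hs)
  calc wealthVal M c s ≤ (M.marg s.1 + M.margVal c 0) * s.1 := by
        unfold wealthVal
        gcongr
        exact hc.marg_le_add _
    _ = M.marg s.1 * s.1 + M.margVal c 0 * s.1 := add_mul _ _ _
    _ ≤ (M.marg 1 * s.1 + M.marg s.1) + M.margVal c 0 * s.1 := by
        gcongr
        exact hU.marg_mul_self_le _
    _ = (M.marg 1 + M.margVal c 0) * s.1 + 1 * M.marg s.1 := by ring
    _ ≤ (M.marg 1 + M.margVal c 0) * (1 + s.1 + M.marg s.1) + 1 * (1 + s.1 + M.marg s.1) := by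
        gcongr
        · exact le_trans le_add_self le_self_add
        · exact le_add_self
    _ = _ := by ring

/-- An Euler policy dominates every feasible policy, strictly so at states where they differ. -/
theorem lifetimeValue_le (hM : M.Assumptions) (hc : M.EulerPolicy c) {d : ℝ≥0 × Z → ℝ≥0}
    (hd : Feasible d) {s : ℝ≥0 × Z} (hs : 0 < s.1) :
    M.lifetimeValue d s ≤ M.lifetimeValue (fun s => c s.1) s ∧
      (d s ≠ c s.1 → M.lifetimeValue d s < M.lifetimeValue (fun s => c s.1) s) := by
  have hU := hM.utility
  have hcm := hc.feasible.measurable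
  have hf := measurable_nextState (M := M) hcm
  have hf' := measurable_nextState (M := M) hd.measurable
  have hW := measurable_wealthVal hU hc
  obtain ⟨δ, hδpos, hδ⟩ := hU.exists_concavity_gap (hc.pos hs) (d s)
  -- With a common initial state the wealth terms cancel. The concavity gap of the initial period is
  -- retained to obtain strictness.
  have key (T : ℕ) :
      ∑ t ∈ Finset.range (T + 1), discTerm (M.nextState d) M.shockLaw M.β (M.posPart d) t s +
      ∑ t ∈ Finset.range (T + 1), discTerm (M.nextState fun s => c s.1) M.shockLaw M.β
        (M.negPart fun s => c s.1) t s + δ ≤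
      ∑ t ∈ Finset.range (T + 1), discTerm (M.nextState fun s => c s.1) M.shockLaw M.β
        (M.posPart fun s => c s.1) t s +
      ∑ t ∈ Finset.range (T + 1), discTerm (M.nextState d) M.shockLaw M.β (M.negPart d) t s +
        discTerm (M.nextState fun s => c s.1) M.shockLaw M.β (wealthVal M c) (T + 1) s := by
    have hfin : M.marg (c s.1) * s.1 ≠ ⊤ :=
      ENNReal.mul_ne_top (marg_ne_top (hc.pos hs)) ENNReal.coe_ne_top
    refine (ENNReal.add_le_add_iff_right hfin).1 ?_
    rw [sum_discTerm_succ hf' (hU.measurable_posPart hd.measurable),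
      sum_discTerm_succ hf' (hU.measurable_negPart hd.measurable),
      sum_discTerm_succ hf (hU.measurable_posPart hcm),
      sum_discTerm_succ hf (hU.measurable_negPart hcm), discTerm_succ hf hW, add_right_comm]
    refine comparison_step hM hc hd ?_ ?_ ?_ ?_ ?_ (hc.comparison hM hd T) hδ
    · exact Finset.measurable_fun_sum _ fun t _ =>
        measurable_discTerm hf' (hU.measurable_posPart hd.measurable) t
    · exact Finset.measurable_fun_sum _ fun t _ =>
        measurable_discTerm hf (hU.measurable_negPart hcm) t
    · exact Finset.measurable_fun_sum _ fun t _ =>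
        measurable_discTerm hf (hU.measurable_posPart hcm) t
    · exact Finset.measurable_fun_sum _ fun t _ =>
        measurable_discTerm hf' (hU.measurable_negPart hd.measurable) t
    · exact measurable_discTerm hf hW T
  have hlim (d : ℝ≥0 × Z → ℝ≥0) (φ : ℝ≥0 × Z → ℝ≥0∞) :
      Tendsto (fun T => ∑ t ∈ Finset.range (T + 1),
        discTerm (M.nextState d) M.shockLaw M.β φ t s) atTop (𝓝 (M.discVal d φ s)) :=
    (tendsto_add_atTop_iff_nat 1).2 (ENNReal.summable.hasSum.tendsto_sum_nat)
  -- The remainder is a term of a convergent series.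
  have htail : Tendsto (fun T => discTerm (M.nextState fun s => c s.1) M.shockLaw M.β
      (wealthVal M c) (T + 1) s) atTop (𝓝 0) :=
    (tendsto_add_atTop_iff_nat 1).2
      (ENNReal.tendsto_atTop_zero_of_tsum_ne_top (hc.discVal_wealthVal_ne_top hM hs))
  have hmain := le_of_tendsto_of_tendsto'
    (((hlim d (M.posPart d)).add (hlim (fun s => c s.1) (M.negPart fun s => c s.1))).add
      (tendsto_const_nhds (x := δ)))
    (((hlim (fun s => c s.1) (M.posPart fun s => c s.1)).add (hlim d (M.negPart d))).add htail) key
  rw [add_zero] at hmain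
  rw [lifetimeValue_eq hU hd.measurable, lifetimeValue_eq hU hcm]
  obtain ⟨h1, h2⟩ := ENNReal.coe_sub_le_coe_sub (discVal_posPart_ne_top hM hd hs)
    (hc.discVal_negPart_ne_top hM hs) (discVal_posPart_ne_top hM hc.feasible hs) hmain
  exact ⟨h1, fun h => h2 (hδpos h)⟩

lemma isOptimal (hM : M.Assumptions) (hc : M.EulerPolicy c) : M.IsOptimal fun s => c s.1 :=
  ⟨hc.feasible, fun _ hd _ _ ha => (hc.lifetimeValue_le hM hd ha).1⟩

lemma eq_of_isOptimal (hM : M.Assumptions) (hc : M.EulerPolicy c) {d : ℝ≥0 × Z → ℝ≥0}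
    (hd : M.IsOptimal d) : d = fun s => c s.1 := by
  funext ⟨a, z⟩
  rcases eq_zero_or_pos a with rfl | ha
  · exact (le_antisymm (hd.1.le 0 z) zero_le).trans (le_antisymm (hc.le 0) zero_le).symm
  · by_contra h
    exact absurd ((hc.lifetimeValue_le hM hd.1 (s := (a, z)) ha).2 h)
      (not_lt.2 (hd.2 _ hc.feasible a z ha))

end EulerPolicy

end IncomeFluctuation

/-! ### Conditioning on the first shock. -/

section

variable {S : Type*} [MeasurableSpace S] (ν : Measure S) [IsProbabilityMeasure ν]

lemma measure_infinitePi_eq_seqCons {B : Set (ℕ → S)} (hB : MeasurableSet B) :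
    Measure.infinitePi (fun _ : ℕ => ν) B =
      ∫⁻ x, Measure.infinitePi (fun _ : ℕ => ν) {w | seqCons x w ∈ B} ∂ν := by
  rw [← (measurePreserving_seqCons ν).measure_preimage hB.nullMeasurableSet,
    Measure.prod_apply (measurable_seqCons hB)]
  rfl

lemma ae_ae_seqCons_of_ae {p : (ℕ → S) → Prop}
    (h : ∀ᵐ w ∂Measure.infinitePi (fun _ : ℕ => ν), p w) :
    ∀ᵐ x ∂ν, ∀ᵐ w ∂Measure.infinitePi (fun _ : ℕ => ν), p (seqCons x w) :=
  Measure.ae_ae_of_ae_prod ((measurePreserving_seqCons ν).quasiMeasurePreserving.ae h)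

end

/-! ### Paths that avoid a set -/

section Avoidance

variable {X S : Type*} {f : X → S → X} {G A : Set X}

/-- Shock sequences along which the path from `a` stays in `G` for the first `n` periods. -/
def staySet (f : X → S → X) (G : Set X) (n : ℕ) (a : X) : Set (ℕ → S) :=
  {w | ∀ t < n, iterPath f a w t ∈ G}

lemma staySet_anti (a : X) : Antitone fun n => staySet f G n a :=
  fun _ _ hmn _ hw t ht => hw t (ht.trans_le hmn)

lemma seqCons_mem_staySet_succ {n : ℕ} {a : X} {x : S} {w : ℕ → S} :
    seqCons x w ∈ staySet f G (n + 1) a ↔ a ∈ G ∧ w ∈ staySet f G n (f a x) := by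
  constructor
  · intro h
    refine ⟨h 0 (Nat.succ_pos n), fun t ht => ?_⟩
    have := h (t + 1) (by omega)
    rwa [iterPath_succ'] at this
  · rintro ⟨h0, h⟩ t ht
    cases t with
    | zero => exact h0
    | succ t =>
      rw [iterPath_succ']
      exact h t (by omega)

variable [MeasurableSpace X] [MeasurableSpace S] {ν : Measure S} [IsProbabilityMeasure ν]

lemma measurableSet_staySet (hf : Measurable fun p : X × S => f p.1 p.2) (hG : MeasurableSet G)
    (n : ℕ) (a : X) : MeasurableSet (staySet f G n a) := by
  have : staySet f G n a = ⋂ t, ⋂ (_ : t < n), (fun w => iterPath f a w t) ⁻¹' G := by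
    ext w; simp [staySet]
  rw [this]
  exact .iInter fun t => .iInter fun _ => measurable_iterPath_right hf a t hG

/-- The Markov property at time `n`, restricted to paths that are in `A` at that time. -/
lemma measure_staySet_add_inter_le (hf : Measurable fun p : X × S => f p.1 p.2)
    (hG : MeasurableSet G) (hA : MeasurableSet A) {T : ℕ} {θ : ℝ≥0∞} (hθ_top : θ ≠ ⊤)
    (hθ : ∀ a ∈ A, Measure.infinitePi (fun _ : ℕ => ν) (staySet f G T a) ≤ θ) (n : ℕ) (a : X) :
    Measure.infinitePi (fun _ : ℕ => ν) (staySet f G (n + T) a ∩ {w | iterPath f a w n ∈ A}) ≤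
      θ * Measure.infinitePi (fun _ : ℕ => ν) (staySet f G n a ∩ {w | iterPath f a w n ∈ A}) := by
  set P := Measure.infinitePi fun _ : ℕ => ν
  have hmA (n : ℕ) (a : X) : MeasurableSet {w : ℕ → S | iterPath f a w n ∈ A} :=
    measurable_iterPath_right hf a n hA
  have hm (k n : ℕ) (a : X) :
      MeasurableSet (staySet f G k a ∩ {w | iterPath f a w n ∈ A}) :=
    (measurableSet_staySet hf hG k a).inter (hmA n a)
  have hcons (k n : ℕ) (a : X) (x : S) :
      {w | seqCons x w ∈ staySet f G (k + 1) a ∩ {w | iterPath f a w (n + 1) ∈ A}} =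
        {w | a ∈ G ∧ w ∈ staySet f G k (f a x) ∩ {w | iterPath f (f a x) w n ∈ A}} := by
    ext w
    change (seqCons x w ∈ staySet f G (k + 1) a ∧ iterPath f a (seqCons x w) (n + 1) ∈ A) ↔
      (a ∈ G ∧ w ∈ staySet f G k (f a x) ∧ iterPath f (f a x) w n ∈ A)
    rw [seqCons_mem_staySet_succ, iterPath_succ', and_assoc]
    rfl
  induction n generalizing a with
  | zero =>
    by_cases ha : a ∈ A
    · have h1 : staySet f G 0 a ∩ {w | iterPath f a w 0 ∈ A} = Set.univ := by
        ext w; simpa [staySet, iterPath] using ha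
      rw [h1, measure_univ, mul_one, zero_add]
      exact (measure_mono Set.inter_subset_left).trans (hθ a ha)
    · have h1 : {w : ℕ → S | iterPath f a w 0 ∈ A} = ∅ := by
        ext w; simpa [iterPath] using ha
      simp [h1]
  | succ n ih =>
    rw [Nat.succ_add, measure_infinitePi_eq_seqCons ν (hm _ _ _),
      measure_infinitePi_eq_seqCons ν (hm _ _ _)]
    simp only [Nat.succ_eq_add_one, hcons]
    by_cases ha : a ∈ G
    · simp only [ha, true_and, Set.ofPred_mem_eq]
      exact (lintegral_mono fun x => ih (f a x)).trans_eq (lintegral_const_mul' _ _ hθ_top)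
    · simp [ha]

end Avoidance

namespace IncomeFluctuation

variable {m : ℕ} {Z : Set (EuclideanSpace ℝ (Fin m))} {E F : Type*}
  [MeasurableSpace E] [MeasurableSpace F] {M : IncomeFluctuation Z E F}

instance : IsProbabilityMeasure M.seqLaw := by unfold seqLaw; infer_instance

namespace EulerPolicy

variable {c : ℝ≥0 → ℝ≥0}

/-! ### Dynamics of wealth -/

lemma measurable_next (hc : M.EulerPolicy c) :
    Measurable fun p : ℝ≥0 × (Z × E × F) => M.nextAsset c p.1 p.2 :=
  M.measurable_nextAsset hc.continuous.measurable

lemma nextAsset_mono (hc : M.EulerPolicy c) (x : Z × E × F) :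
    Monotone fun a => M.nextAsset c a x := by
  intro a b hab
  have := hc.sav_mono hab
  simp only at this
  simp only [nextAsset]
  gcongr

lemma iterPath_mono (hc : M.EulerPolicy c) {a b : ℝ≥0} (hab : a ≤ b) (w : ℕ → Z × E × F) (t : ℕ) :
    iterPath (M.nextAsset c) a w t ≤ iterPath (M.nextAsset c) b w t := by
  induction t with
  | zero => exact hab
  | succ t ih => exact hc.nextAsset_mono _ ih

/-- Wealth grows on average at a rate below one, up to income. -/
lemma exists_drift (hc : M.EulerPolicy c) : ∃ ρ < (1 : ℝ≥0∞),
    ∃ γ : ℝ≥0, (γ : ℝ≥0∞) * ∫⁻ x, (M.ret x : ℝ≥0∞) ∂M.shockLaw = ρ ∧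
      ∀ a x, (M.nextAsset c a x : ℝ≥0∞) ≤ (M.ret x : ℝ≥0∞) * (γ * a) + M.inc x := by
  obtain ⟨α, -, h1, hle⟩ := hc.rate
  refine ⟨_, h1, 1 - α, rfl, fun a x => ?_⟩
  simp only [nextAsset]
  norm_cast
  gcongr
  rw [tsub_mul, one_mul]
  exact tsub_le_tsub_left (hle a) a

lemma exists_lintegral_iterPath_le (hM : M.Assumptions) (hc : M.EulerPolicy c) (a : ℝ≥0) :
    ∃ C : ℝ≥0∞, C ≠ ⊤ ∧ ∀ n,
      ∫⁻ w, ((iterPath (M.nextAsset c) a w n : ℝ≥0) : ℝ≥0∞) ∂M.seqLaw ≤ C := by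
  obtain ⟨ρ, hρ, γ, hγ, hle⟩ := hc.exists_drift
  set EY := ∫⁻ x, (M.inc x : ℝ≥0∞) ∂M.shockLaw with hEY
  have hr := M.measurable_ret.coe_nnreal_ennreal
  have hy := M.measurable_inc.coe_nnreal_ennreal
  have hstep (a : ℝ≥0) : ∫⁻ x, (M.nextAsset c a x : ℝ≥0∞) ∂M.shockLaw ≤ ρ * a + EY := by
    calc _ ≤ ∫⁻ x, ((M.ret x : ℝ≥0∞) * (γ * a) + M.inc x) ∂M.shockLaw :=
          lintegral_mono fun x => hle a x
      _ = _ := by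
          rw [lintegral_add_right _ hy, lintegral_mul_const _ hr, ← hγ]; ring
  have key (n : ℕ) (a : ℝ≥0) : ∫⁻ w, ((iterPath (M.nextAsset c) a w n : ℝ≥0) : ℝ≥0∞) ∂M.seqLaw ≤
      ρ ^ n * a + EY * ∑ k ∈ Finset.range n, ρ ^ k := by
    induction n generalizing a with
    | zero => simp [iterPath]
    | succ n ih =>
      have hmeas : Measurable fun w : ℕ → Z × E × F =>
          ((iterPath (M.nextAsset c) a w (n + 1) : ℝ≥0) : ℝ≥0∞) :=
        (measurable_iterPath_right hc.measurable_next a (n + 1)).coe_nnreal_ennreal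
      have hnm : Measurable fun x => (M.nextAsset c a x : ℝ≥0∞) :=
        (hc.measurable_next.comp measurable_prodMk_left).coe_nnreal_ennreal
      rw [seqLaw, lintegral_infinitePi_eq_seqCons M.shockLaw hmeas]
      simp only [iterPath_succ', seqCons_zero, seqShift_seqCons]
      calc _ ≤ ∫⁻ x, (ρ ^ n * (M.nextAsset c a x : ℝ≥0∞) + EY * ∑ k ∈ Finset.range n, ρ ^ k)
            ∂M.shockLaw := lintegral_mono fun x => ih _
        _ = ρ ^ n * ∫⁻ x, (M.nextAsset c a x : ℝ≥0∞) ∂M.shockLaw +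
              EY * ∑ k ∈ Finset.range n, ρ ^ k := by
            rw [lintegral_add_right _ measurable_const, lintegral_const_mul _ hnm, lintegral_const,
              measure_univ, mul_one]
        _ ≤ ρ ^ n * (ρ * a + EY) + EY * ∑ k ∈ Finset.range n, ρ ^ k := by
            gcongr
            exact hstep a
        _ = _ := by rw [Finset.sum_range_succ, pow_succ]; ring
  refine ⟨a + EY * (1 - ρ)⁻¹, ENNReal.add_ne_top.2 ⟨ENNReal.coe_ne_top,
    ENNReal.mul_ne_top hM.inc_finite.ne (ENNReal.inv_ne_top.2 (tsub_pos_of_lt hρ).ne')⟩,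
    fun n => (key n a).trans ?_⟩
  gcongr
  · calc ρ ^ n * a ≤ 1 * a := by gcongr; exact pow_le_one₀ zero_le hρ.le
      _ = a := one_mul _
  · rw [← ENNReal.tsum_geometric]
    exact ENNReal.sum_le_tsum _

/-! ### Recurrence to the region without savings -/

lemma measurableSet_savPos (hc : M.EulerPolicy c) : MeasurableSet {a | 0 < a - c a} :=
  measurableSet_lt measurable_const (measurable_id.sub hc.continuous.measurable)

/-- If savings are almost surely positive for `n + 1` periods, the Euler equation iterates. -/
lemma marg_le_of_ae_staySet (hM : M.Assumptions) (hc : M.EulerPolicy c) (n : ℕ) (a : ℝ≥0)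
    (h : ∀ᵐ w ∂M.seqLaw, w ∈ staySet (M.nextAsset c) {a | 0 < a - c a} (n + 1) a) :
    M.marg (c a) ≤
      (M.β * ∫⁻ x, (M.ret x : ℝ≥0∞) ∂M.shockLaw) ^ n * M.margVal c 0 := by
  have hpos : 0 < a - c a := by
    obtain ⟨w, hw⟩ := h.exists
    exact hw 0 (Nat.succ_pos n)
  have hge := hc.euler_ge a hpos
  induction n generalizing a with
  | zero =>
    rw [pow_zero, one_mul]
    exact hge.trans (hc.margVal_le_zero hM.utility _)
  | succ n ih =>
    refine hge.trans ?_
    -- After almost every first shock the continuation saves for `n + 1` periods almost surely, so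
    -- the bound for `n` applies to next period's marginal utility.
    have hae := ae_ae_seqCons_of_ae M.shockLaw h
    have hr := M.measurable_ret.coe_nnreal_ennreal
    calc M.margVal c (a - c a)
        ≤ M.β * ∫⁻ x, (M.ret x : ℝ≥0∞) *
            ((M.β * ∫⁻ x, (M.ret x : ℝ≥0∞) ∂M.shockLaw) ^ n * M.margVal c 0) ∂M.shockLaw := by
          unfold margVal
          gcongr 1
          refine lintegral_mono_ae ?_
          filter_upwards [hae] with x hx
          gcongr
          have hx' : ∀ᵐ w ∂M.seqLaw, w ∈ staySet (M.nextAsset c) {a | 0 < a - c a} (n + 1)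
              (M.nextAsset c a x) := hx.mono fun w hw => (seqCons_mem_staySet_succ.1 hw).2
          have hp : 0 < M.nextAsset c a x - c (M.nextAsset c a x) := by
            obtain ⟨w, hw⟩ := hx'.exists
            exact hw 0 (Nat.succ_pos n)
          exact ih _ hx' hp (hc.euler_ge _ hp)
      _ = _ := by
          rw [lintegral_mul_const _ hr, pow_succ]; ring

/-- From wealth at most `A` there is a uniformly positive probability of a period without
savings. -/
lemma exists_measure_staySet_lt_one (hM : M.Assumptions) (hc : M.EulerPolicy c) (A : ℝ≥0) :
    ∃ T, M.seqLaw (staySet (M.nextAsset c) {a | 0 < a - c a} T A) < 1 := by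
  have hlim : Tendsto (fun n => (M.β * ∫⁻ x, (M.ret x : ℝ≥0∞) ∂M.shockLaw) ^ n * M.margVal c 0)
      atTop (𝓝 (0 * M.margVal c 0)) :=
    ENNReal.Tendsto.mul_const (ENNReal.tendsto_pow_atTop_nhds_zero_of_lt_one hM.β_mul_ret_lt_one)
      (Or.inr hc.margVal_ne_top)
  rw [zero_mul] at hlim
  obtain ⟨n, hn⟩ := (hlim.eventually_lt_const (hM.utility.marg_pos (c A))).exists
  refine ⟨n + 1, lt_of_le_of_ne prob_le_one fun h1 => ?_⟩
  have hae := (mem_ae_iff_prob_eq_one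
    (measurableSet_staySet hc.measurable_next hc.measurableSet_savPos (n + 1) A)).2 h1
  exact absurd (hc.marg_le_of_ae_staySet hM n A hae) (not_le.2 hn)

/-- Let `p n` be the probability of positive savings for `n` periods. From wealth at most `A`, `T`
further such periods have probability at most `θ < 1`; wealth exceeds `A` with probability at most
`C / A` by Markov's inequality. Hence `p (n + T) ≤ p n - (1 - θ)(p n - C / A)`, so `lim p ≤ C / A`
for every `A > 0`. -/
lemma ae_exists_sav_eq_zero (hM : M.Assumptions) (hc : M.EulerPolicy c) (a : ℝ≥0) :
    ∀ᵐ w ∂M.seqLaw, ∃ t,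
      iterPath (M.nextAsset c) a w t - c (iterPath (M.nextAsset c) a w t) = 0 := by
  set f := M.nextAsset c with hf
  set G := {a | 0 < a - c a} with hG
  have hfm := hc.measurable_next
  have hGm := hc.measurableSet_savPos
  obtain ⟨C, hC, hCn⟩ := hc.exists_lintegral_iterPath_le hM a
  set I := ⋂ n, staySet f G n a with hI
  have hlim : Tendsto (fun n => M.seqLaw.real (staySet f G n a)) atTop (𝓝 (M.seqLaw.real I)) := by
    refine (ENNReal.tendsto_toReal (measure_ne_top _ _)).comp ?_
    exact tendsto_measure_iInter_atTop
      (fun n => (measurableSet_staySet hfm hGm n a).nullMeasurableSet) (staySet_anti a)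
      ⟨0, measure_ne_top _ _⟩
  have key (A : ℝ≥0) (hA : 0 < A) : M.seqLaw.real I ≤ C.toReal / A := by
    obtain ⟨T, hT⟩ := hc.exists_measure_staySet_lt_one hM A
    set θ := M.seqLaw.real (staySet f G T A) with hθ
    have hθ1 : θ < 1 := by
      have := (ENNReal.toReal_lt_toReal (measure_ne_top _ _) ENNReal.one_ne_top).2 hT
      rwa [ENNReal.toReal_one] at this
    have hstep (n : ℕ) : M.seqLaw.real (staySet f G (n + T) a) ≤
        M.seqLaw.real (staySet f G n a) -
          (1 - θ) * (M.seqLaw.real (staySet f G n a) - C.toReal / A) := by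
      set B : Set (ℕ → Z × E × F) := {w | iterPath f a w n ∈ Set.Iic A} with hB
      have hBm : MeasurableSet B := measurable_iterPath_right hfm a n measurableSet_Iic
      have h1 : M.seqLaw.real (staySet f G (n + T) a ∩ B) ≤
          θ * M.seqLaw.real (staySet f G n a ∩ B) := by
        have := measure_staySet_add_inter_le (ν := M.shockLaw) hfm hGm (A := Set.Iic A)
          measurableSet_Iic (T := T) (θ := M.seqLaw (staySet f G T A)) (measure_ne_top _ _)
          (fun b hb => ?_) n a
        · have h2 := ENNReal.toReal_mono (ENNReal.mul_ne_top (measure_ne_top _ _)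
            (measure_ne_top _ _)) this
          rw [ENNReal.toReal_mul] at h2
          exact h2
        -- Savings increase with initial wealth along a fixed shock sequence, so the bound at `A`
        -- covers every start below it.
        · refine measure_mono fun w hw t ht => ?_
          exact lt_of_lt_of_le (hw t ht) (hc.sav_mono (hc.iterPath_mono hb w t))
      have h2 : M.seqLaw.real (staySet f G (n + T) a \ B) ≤
          M.seqLaw.real (staySet f G n a \ B) :=
        measureReal_mono (Set.sdiff_subset_sdiff_left (staySet_anti a (Nat.le_add_right n T)))
      have h3 := measureReal_inter_add_sdiff (μ := M.seqLaw) (s := staySet f G (n + T) a) hBm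
      have h4 := measureReal_inter_add_sdiff (μ := M.seqLaw) (s := staySet f G n a) hBm
      have h5 : M.seqLaw.real (staySet f G n a \ B) ≤ C.toReal / A := by
        have hmk : M.seqLaw Bᶜ ≤ C / A := by
          have hle : Bᶜ ⊆ {w | (A : ℝ≥0∞) ≤ ((iterPath f a w n : ℝ≥0) : ℝ≥0∞)} := by
            intro w hw
            have : A < iterPath f a w n := not_le.1 hw
            exact ENNReal.coe_le_coe.2 this.le
          refine (measure_mono hle).trans ((meas_ge_le_lintegral_div
            (measurable_iterPath_right hfm a n).coe_nnreal_ennreal.aemeasurable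
            (by simpa using hA.ne') ENNReal.coe_ne_top).trans ?_)
          gcongr
          exact hCn n
        have h6 := ENNReal.toReal_mono (ENNReal.div_ne_top hC (by simpa using hA.ne')) hmk
        rw [ENNReal.toReal_div, ENNReal.coe_toReal] at h6
        exact (measureReal_mono (fun w hw => hw.2)).trans h6
      nlinarith
    have hl := le_of_tendsto_of_tendsto' ((tendsto_add_atTop_iff_nat T).2 hlim)
      (hlim.sub ((hlim.sub_const (C.toReal / A)).const_mul (1 - θ))) hstep
    nlinarith
  have hzero : M.seqLaw.real I = 0 := by
    refine le_antisymm ?_ measureReal_nonneg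
    have hl : Tendsto (fun n : ℕ => C.toReal / ((n : ℝ) + 1)) atTop (𝓝 0) := by
      have := tendsto_one_div_add_atTop_nhds_zero_nat (𝕜 := ℝ).const_mul C.toReal
      simpa only [mul_one_div, mul_zero] using this
    refine ge_of_tendsto' hl fun n => ?_
    have := key (n + 1) (by positivity)
    simpa using this
  have hI0 : M.seqLaw I = 0 := (measureReal_eq_zero_iff (measure_ne_top _ _)).1 hzero
  filter_upwards [measure_eq_zero_iff_ae_notMem.1 hI0] with w hw
  by_contra! hcon
  exact hw (Set.mem_iInter.2 fun n t _ => pos_of_ne_zero (hcon t))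

/-- Once the path from `max a b` saves nothing, neither do the paths below it. Wealth next period is
then the same income for both, and the paths agree from there on. -/
lemma coalescing (hM : M.Assumptions) (hc : M.EulerPolicy c) :
    Coalescing (M.nextAsset c) M.shockLaw := by
  intro a b
  filter_upwards [hc.ae_exists_sav_eq_zero hM (max a b)] with w hw
  obtain ⟨t, ht⟩ := hw
  have hzero {e : ℝ≥0} (he : e ≤ max a b) :
      iterPath (M.nextAsset c) e w t - c (iterPath (M.nextAsset c) e w t) = 0 :=
    le_antisymm ((hc.sav_mono (hc.iterPath_mono he w t)).trans ht.le) zero_le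
  refine eventually_atTop.2 ⟨t + 1, fun n hn => ?_⟩
  induction n, hn using Nat.le_induction with
  | base =>
    simp only [iterPath, nextAsset, hzero (le_max_left a b), hzero (le_max_right a b)]
  | succ n _ ih => simp only [iterPath, ih]

/-! ### Existence of a stationary distribution -/

/-- Backward iterates from zero wealth. -/
def backIter (M : IncomeFluctuation Z E F) (c : ℝ≥0 → ℝ≥0) : ℕ → (ℕ → Z × E × F) → ℝ≥0
  | 0 => fun _ => 0
  | n + 1 => fun w => M.nextAsset c (backIter M c n (seqShift w)) (w 0)

lemma measurable_backIter (hc : M.EulerPolicy c) (n : ℕ) : Measurable (backIter M c n) := by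
  induction n with
  | zero => exact measurable_const
  | succ n ih =>
    exact hc.measurable_next.comp ((ih.comp measurable_seqShift).prodMk (measurable_pi_apply 0))

/-- One more shock in the distant past replaces zero, the least initial wealth, by something larger,
and the recursion is monotone. -/
lemma backIter_le_succ (hc : M.EulerPolicy c) (n : ℕ) (w : ℕ → Z × E × F) :
    backIter M c n w ≤ backIter M c (n + 1) w := by
  induction n generalizing w with
  | zero => exact zero_le
  | succ n ih => exact hc.nextAsset_mono _ (ih _)

/-- The drift bound keeps the means below `κ`. By monotone convergence the supremum has mean at most
`κ`, so it is almost surely finite. -/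
lemma ae_bddAbove_backIter (hM : M.Assumptions) (hc : M.EulerPolicy c) :
    ∀ᵐ w ∂M.seqLaw, BddAbove (Set.range fun n => backIter M c n w) := by
  obtain ⟨ρ, hρ, γ, hγ, hle⟩ := hc.exists_drift
  have hr := M.measurable_ret.coe_nnreal_ennreal
  have hy := M.measurable_inc.coe_nnreal_ennreal
  have hmb (n : ℕ) : Measurable fun w => (backIter M c n w : ℝ≥0∞) :=
    (hc.measurable_backIter n).coe_nnreal_ennreal
  set EY := ∫⁻ x, (M.inc x : ℝ≥0∞) ∂M.shockLaw with hEY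
  set κ := EY / (1 - ρ) with hκ
  have hκ' : κ ≠ ⊤ := ENNReal.div_ne_top hM.inc_finite.ne (tsub_pos_of_lt hρ).ne'
  have hmean (n : ℕ) : ∫⁻ w, (backIter M c n w : ℝ≥0∞) ∂M.seqLaw ≤ κ := by
    induction n with
    | zero => simp [backIter]
    | succ n ih =>
      have hcons : ∫⁻ w, (backIter M c (n + 1) w : ℝ≥0∞) ∂M.seqLaw = ∫⁻ x, ∫⁻ w,
          (M.nextAsset c (backIter M c n w) x : ℝ≥0∞) ∂M.seqLaw ∂M.shockLaw :=
        lintegral_infinitePi_eq_seqCons M.shockLaw (hmb (n + 1))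
      rw [hcons]
      calc _ ≤ ∫⁻ x, ((M.ret x : ℝ≥0∞) * (γ * κ) + M.inc x) ∂M.shockLaw := by
            refine lintegral_mono fun x => ?_
            calc _ ≤ ∫⁻ w, ((M.ret x : ℝ≥0∞) * (γ * backIter M c n w) + M.inc x) ∂M.seqLaw :=
                  lintegral_mono fun w => hle (backIter M c n w) x
              _ = (M.ret x : ℝ≥0∞) * (γ * ∫⁻ w, (backIter M c n w : ℝ≥0∞) ∂M.seqLaw) +
                    M.inc x := by
                  rw [lintegral_add_right _ measurable_const,
                    lintegral_const_mul _ ((hmb n).const_mul _), lintegral_const_mul _ (hmb n),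
                    lintegral_const, measure_univ, mul_one]
              _ ≤ _ := by gcongr
        _ = EY + ρ * κ := by
            rw [lintegral_add_right _ hy, lintegral_mul_const _ hr, ← hγ]; ring
        _ = κ := ENNReal.add_mul_div_one_sub hρ EY
  have hsup : ∫⁻ w, ⨆ n, (backIter M c n w : ℝ≥0∞) ∂M.seqLaw ≤ κ := by
    rw [lintegral_iSup hmb (monotone_nat_of_le_succ fun n w =>
      ENNReal.coe_le_coe.2 (hc.backIter_le_succ n w))]
    exact iSup_le hmean
  filter_upwards [ae_lt_top (.iSup hmb) (ne_top_of_le_ne_top hκ' hsup)] with w hw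
  exact ENNReal.iSup_coe_lt_top.1 hw

/-- The limit `X` of the backward iterates satisfies `X w = f (X (shift w)) (w 0)`, where `f` is the
wealth recursion. Since `X (shift w)` has the law of `X` and is independent of `w 0`, that law is
stationary. -/
theorem exists_stationary (hM : M.Assumptions) (hc : M.EulerPolicy c) :
    ∃ ψ : Measure ℝ≥0, IsProbabilityMeasure ψ ∧
      (ψ.prod M.shockLaw).map (fun p => M.nextAsset c p.1 p.2) = ψ := by
  -- An unbounded supremum in `ℝ≥0` takes the default value `0`, but only on a null set.
  set X : (ℕ → Z × E × F) → ℝ≥0 := fun w => ⨆ n, backIter M c n w with hX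
  have hXm : Measurable X := .iSup hc.measurable_backIter
  have hbdd := hc.ae_bddAbove_backIter hM
  have hshift := measurePreserving_seqShift M.shockLaw
  have hlim {w : ℕ → Z × E × F} (h : BddAbove (Set.range fun n => backIter M c n w)) :
      Tendsto (fun n => backIter M c n w) atTop (𝓝 (X w)) :=
    tendsto_atTop_ciSup (monotone_nat_of_le_succ fun n => hc.backIter_le_succ n w) h
  have hfix : ∀ᵐ w ∂M.seqLaw, X w = M.nextAsset c (X (seqShift w)) (w 0) := by
    filter_upwards [hbdd, hshift.quasiMeasurePreserving.ae hbdd] with w h1 h2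
    have hcont : Continuous fun a => M.nextAsset c a (w 0) :=
      (continuous_const.mul (continuous_id.sub hc.continuous)).add continuous_const
    exact tendsto_nhds_unique ((tendsto_add_atTop_iff_nat 1).2 (hlim h1))
      ((hcont.tendsto _).comp (hlim h2))
  refine ⟨M.seqLaw.map X, Measure.isProbabilityMeasure_map hXm.aemeasurable, ?_⟩
  have hcons := measurePreserving_seqCons M.shockLaw
  have hmp : MeasurePreserving (Prod.map X (id : Z × E × F → Z × E × F))
      (M.seqLaw.prod M.shockLaw) ((M.seqLaw.map X).prod M.shockLaw) :=
    (hXm.measurePreserving _).prod (MeasurePreserving.id _)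
  have hswap : MeasurePreserving (Prod.swap : (ℕ → Z × E × F) × (Z × E × F) → _)
      (M.seqLaw.prod M.shockLaw) (M.shockLaw.prod M.seqLaw) := Measure.measurePreserving_swap
  have hcs := MeasurePreserving.comp hcons hswap
  rw [← hmp.map_eq, Measure.map_map hc.measurable_next hmp.measurable]
  have hmap : M.seqLaw.map X = M.seqLaw.map fun w => M.nextAsset c (X (seqShift w)) (w 0) :=
    Measure.map_congr hfix
  have hm2 : Measurable fun w : ℕ → Z × E × F => M.nextAsset c (X (seqShift w)) (w 0) :=
    hc.measurable_next.comp ((hXm.comp measurable_seqShift).prodMk (measurable_pi_apply 0))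
  rw [hmap]
  conv_rhs => rw [seqLaw, ← hcs.map_eq, Measure.map_map hm2 hcs.measurable]
  rfl

lemma invariant_assetKernel_iff (hc : M.EulerPolicy c) (φ : Measure ℝ≥0) [IsProbabilityMeasure φ] :
    (M.assetKernel hc.continuous.measurable).Invariant φ ↔
      (φ.prod M.shockLaw).map (fun p => M.nextAsset c p.1 p.2) = φ := by
  have : φ.bind (M.assetKernel hc.continuous.measurable) =
      (φ.prod M.shockLaw).map fun p => M.nextAsset c p.1 p.2 := by
    refine Measure.ext fun B hB => ?_
    rw [Measure.bind_apply hB (Kernel.aemeasurable _), Measure.map_apply hc.measurable_next hB,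
      Measure.prod_apply (hc.measurable_next hB)]
    refine lintegral_congr fun a => ?_
    exact Measure.map_apply (hc.measurable_next.comp measurable_prodMk_left) hB
  rw [Kernel.Invariant, this]

end EulerPolicy

/-! ### Wealth paths on general probability spaces -/

namespace IsWealthPath

variable {c : ℝ≥0 → ℝ≥0} {μ₀ : Measure ℝ≥0} {Ω : Type*} [MeasurableSpace Ω] {P : Measure Ω}
  {x : ℕ → Ω → Z × E × F} {a : ℕ → Ω → ℝ≥0}

lemma eq_iterPath (h : M.IsWealthPath c μ₀ P x a) (t : ℕ) (ω : Ω) :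
    a t ω = iterPath (M.nextAsset c) (a 0 ω) (fun t => x t ω) t := by
  induction t with
  | zero => rfl
  | succ t ih => rw [h.step, ih]; rfl

lemma map_eq [IsProbabilityMeasure P] (h : M.IsWealthPath c μ₀ P x a) :
    P.map (fun ω => (a 0 ω, fun t => x t ω)) = μ₀.prod M.seqLaw := by
  have hx : Measurable fun ω t => x t ω := measurable_pi_lambda _ h.measurable_shock
  rw [(indepFun_iff_map_prod_eq_prod_map_map h.measurable_init.aemeasurable
    hx.aemeasurable).1 h.indep_init, h.law_init,
    h.indep_shock.map_fun_eq_infinitePi_map h.measurable_shock]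
  simp only [h.law_shock, seqLaw]

/-- Initial wealth and shocks have a product law, so a property that is almost sure from each fixed
start is almost sure from a random one. -/
lemma ae_of_forall_ae [IsProbabilityMeasure P] [IsProbabilityMeasure μ₀]
    (h : M.IsWealthPath c μ₀ P x a)
    {p : ℝ≥0 × (ℕ → Z × E × F) → Prop} (hp : MeasurableSet {q | p q})
    (hae : ∀ b, ∀ᵐ w ∂M.seqLaw, p (b, w)) : ∀ᵐ ω ∂P, p (a 0 ω, fun t => x t ω) := by
  have hx : Measurable fun ω t => x t ω := measurable_pi_lambda _ h.measurable_shock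
  have : ∀ᵐ q ∂P.map (fun ω => (a 0 ω, fun t => x t ω)), p q := by
    rw [h.map_eq]
    exact (Measure.ae_prod_iff_ae_ae hp).2 (.of_forall hae)
  exact ae_of_ae_map (h.measurable_init.prodMk hx).aemeasurable this

/-- The law of large numbers for a single integrable function. -/
theorem ae_tendsto_average [IsProbabilityMeasure P] [IsProbabilityMeasure μ₀] (hM : M.Assumptions)
    (hc : M.EulerPolicy c) (h : M.IsWealthPath c μ₀ P x a) {ψ : Measure ℝ≥0}
    [IsProbabilityMeasure ψ] (hψ : (ψ.prod M.shockLaw).map (fun p => M.nextAsset c p.1 p.2) = ψ)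
    {g : ℝ≥0 → ℝ} (hg : Measurable g) (hint : Integrable g ψ) :
    ∀ᵐ ω ∂P, Tendsto (fun T : ℕ => (1 / (T : ℝ)) * ∑ t ∈ Finset.range T, g (a (t + 1) ω)) atTop
      (𝓝 (∫ y, g y ∂ψ)) := by
  filter_upwards [h.ae_of_forall_ae
    (measurableSet_tendsto_average_iterPath hc.measurable_next hg (∫ y, g y ∂ψ))
    ((hc.coalescing hM).ae_tendsto_average M.shockLaw hc.measurable_next hψ hg hint)] with ω hω
  simp only [h.eq_iterPath (_ + 1)]
  exact hω

end IsWealthPath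

end IncomeFluctuation

/-! ### The span of increasing functions and the main theorem. -/

lemma measurable_and_integrable_of_mem_increasingSpan {ψ : Measure ℝ≥0} {h : ℝ≥0 → ℝ}
    (hh : h ∈ increasingSpan ψ) : Measurable h ∧ Integrable h ψ := by
  induction hh using Submodule.span_induction with
  | mem h hh => exact ⟨hh.1.measurable, hh.2⟩
  | zero => exact ⟨measurable_const, integrable_zero _ _ _⟩
  | add f g _ _ hf hg => exact ⟨hf.1.add hg.1, hf.2.add hg.2⟩
  | smul k f _ hf => exact ⟨hf.1.const_smul k, hf.2.smul k⟩

theorem theoremt {m : ℕ} (Z : Set (EuclideanSpace ℝ (Fin m))) (hZ : MeasurableSet Z)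
    {E F : Type*} [MeasurableSpace E] [MeasurableSpace F]
    (M : IncomeFluctuation Z E F) (hM : M.Assumptions) :
    -- the optimal policy, a function of wealth only, unique in the candidate class
    ∃ (c : ℝ≥0 → ℝ≥0) (hc : Measurable c),
      (M.Candidate (fun s => c s.1) ∧ M.IsOptimal (fun s => c s.1) ∧
        ∀ d : ℝ≥0 × Z → ℝ≥0, M.Candidate d → M.IsOptimal d → d = fun s => c s.1) ∧
      -- the unique stationary distribution
      ∃ ψ : Measure ℝ≥0,
        (IsProbabilityMeasure ψ ∧ (M.assetKernel hc).Invariant ψ ∧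
          ∀ φ : Measure ℝ≥0, IsProbabilityMeasure φ → (M.assetKernel hc).Invariant φ → φ = ψ) ∧
        -- the law of large numbers, for every version of the wealth process
        ∀ (μ₀ : Measure ℝ≥0) [IsProbabilityMeasure μ₀] (Ω : Type*) [MeasurableSpace Ω]
          (P : Measure Ω) [IsProbabilityMeasure P] (x : ℕ → Ω → Z × E × F) (a : ℕ → Ω → ℝ≥0),
          M.IsWealthPath c μ₀ P x a →
          (∀ h ∈ increasingSpan ψ, ∀ᵐ ω ∂P,
            Tendsto (fun T : ℕ => (1 / (T : ℝ)) * ∑ t ∈ Finset.Icc 1 T, h (a t ω)) atTop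
              (𝓝 (∫ y, h y ∂ψ))) ∧
          (∀ᵐ ω ∂P, ∀ h : ℝ≥0 →ᵇ ℝ,
            Tendsto (fun T : ℕ => (1 / (T : ℝ)) * ∑ t ∈ Finset.Icc 1 T, h (a t ω)) atTop
              (𝓝 (∫ y, h y ∂ψ))) := by
  obtain ⟨c, hc⟩ := hM.exists_eulerPolicy
  refine ⟨c, hc.continuous.measurable, ⟨hc.candidate hM.utility, hc.isOptimal hM,
    fun d _ hd => hc.eq_of_isOptimal hM hd⟩, ?_⟩
  obtain ⟨ψ, hψp, hψ⟩ := hc.exists_stationary hM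
  refine ⟨ψ, ⟨hψp, (hc.invariant_assetKernel_iff ψ).2 hψ, fun φ hφp hφ => ?_⟩, ?_⟩
  · exact (hc.coalescing hM).stationary_unique M.shockLaw hc.measurable_next hψ
      ((hc.invariant_assetKernel_iff φ).1 hφ)
  · intro μ₀ _ Ω _ P _ x a hpath
    refine ⟨fun h hh => ?_, ?_⟩
    · obtain ⟨hm, hi⟩ := measurable_and_integrable_of_mem_increasingSpan hh
      simp only [sum_Icc_one_eq_sum_range (fun t => h (a t _))]
      exact hpath.ae_tendsto_average hM hc hψ hm hi
    -- The exceptional null set must not depend on `h`, so the law of large numbers is applied to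
    -- countably many open sets first.
    · have hfreq : ∀ᵐ ω ∂P, ∀ U ∈ finiteUnionsOfBasis ℝ≥0, Tendsto (fun T : ℕ => (1 / (T : ℝ)) *
          ∑ t ∈ Finset.range T, U.indicator (fun _ => (1 : ℝ)) (a (t + 1) ω)) atTop
            (𝓝 (ψ.real U)) := by
        refine (ae_ball_iff (countable_finiteUnionsOfBasis ℝ≥0)).2 fun U hU => ?_
        have hUm := (isOpen_of_mem_finiteUnionsOfBasis hU).measurableSet
        have := hpath.ae_tendsto_average hM hc hψ
          (measurable_const.indicator hUm) ((integrable_const (1 : ℝ)).indicator hUm)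
        rwa [integral_indicator_const _ hUm, smul_eq_mul, mul_one] at this
      filter_upwards [hfreq] with ω hω h
      simp only [sum_Icc_one_eq_sum_range (fun t => h (a t _))]
      exact tendsto_average_of_tendsto_frequency ψ hω h
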